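/- **Theorem (Sharp fractional Hardy inequality with remainder).** Let $N\ge 1$ be an integer, $0<s<1$ and $p\ge 2$. For a measurable $u:\mathbb R^N\to\mathbb C$ put $$E[u]=\iint_{\mathbb R^N\times\mathbb R^N}\frac{|u(x)-u(y)|^p}{|x-y|^{N+ps}}\,dx\,dy .$$ Let $\dot W^s_p(\mathbb R^N)$ (for $p<N/s$) and $\dot W^s_p(\mathbb R^N\setminus\{0\})$ (for $p>N/s$) be the completions of $C_0^\infty(\mathbb R^N)$ and $C_0^\infty(\mathbb R^N\setminus\{0\})$, respectively, with respect to $E[\cdot]^{1/p}$, realized as spaces of functions: $u$ belongs to the space iff $u$ is the almost everywhere limit of a sequence of such test functions $\varphi_n$ with $E[\varphi_n-\varphi_m]\to0$ as $n,m\to\infty$. Let $$\mathcal C_{N,s,p}=2\int_0^1 r^{ps-1}\left|1-r^{(N-ps)/p}\right|^p\Phi_{N,s,p}(r)\,dr,$$ where $$\Phi_{N,s,p}(r)=|\mathbb S^{N-2}|\int_{-1}^1\frac{(1-t^2)^{(N-3)/2}}{(1-2rt+r^2)^{(N+ps)/2}}\,dt\quad(N\ge2),\qquad \Phi_{1,s,p}(r)=\frac1{(1-r)^{1+ps}}+\frac1{(1+r)^{1+ps}},$$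 and let $$c_p=\min_{0<\tau<1/2}\left((1-\tau)^p-\tau^p+p\tau^{p-1}\right).$$ Then $\mathcal C_{N,s,p}<\infty$ if $p\neq N/s$, the minimum defining $c_p$ is attained, $0<c_p\le1$, and $c_2=1$. Moreover, for all $u\in\dot W^s_p(\mathbb R^N)$ if $p<N/s$, and for all $u\in\dot W^s_p(\mathbb R^N\setminus\{0\})$ if $p>N/s$, with $v(x)=|x|^{(N-ps)/p}u(x)$, all the integrals below are finite and $$E[u]-\mathcal C_{N,s,p}\int_{\mathbb R^N}\frac{|u(x)|^p}{|x|^{ps}}\,dx\;\ge\; c_p\iint_{\mathbb R^N\times\mathbb R^N}\frac{|v(x)-v(y)|^p}{|x-y|^{N+ps}}\,\frac{dx}{|x|^{(N-ps)/2}}\,\frac{dy}{|y|^{(N-ps)/2}} .$$ If $p=2$, this is an equality (with $c_2=1$). -/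

import Mathlib

open MeasureTheory Set Filter Topology
open scoped ENNReal ContDiff

namespace FractionalHardy

/-- The fractional energy
`∬ |u(x) - u(y)|^p / |x - y|^(N + p s) dx dy ∈ [0, ∞]` over `ℝ^N × ℝ^N`. -/
noncomputable def energy (N : ℕ) (s p : ℝ) (u : EuclideanSpace ℝ (Fin N) → ℂ) : ℝ≥0∞ :=
  ∫⁻ z : EuclideanSpace ℝ (Fin N) × EuclideanSpace ℝ (Fin N),
    ENNReal.ofReal (‖u z.1 - u z.2‖ ^ p / ‖z.1 - z.2‖ ^ ((N : ℝ) + p * s))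
    ∂((volume : Measure (EuclideanSpace ℝ (Fin N))).prod volume)

/-- The Hardy term `∫ |u(x)|^p / |x|^(p s) dx ∈ [0, ∞]` over `ℝ^N`. -/
noncomputable def hardyIntegral (N : ℕ) (s p : ℝ) (u : EuclideanSpace ℝ (Fin N) → ℂ) : ℝ≥0∞ :=
  ∫⁻ x : EuclideanSpace ℝ (Fin N), ENNReal.ofReal (‖u x‖ ^ p / ‖x‖ ^ (p * s))

/-- The weighted fractional energy
`∬ |v(x) - v(y)|^p / |x - y|^(N + p s) dx / |x|^((N - p s)/2) dy / |y|^((N - p s)/2) ∈ [0, ∞]`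
over `ℝ^N × ℝ^N`. -/
noncomputable def weightedEnergy (N : ℕ) (s p : ℝ) (v : EuclideanSpace ℝ (Fin N) → ℂ) : ℝ≥0∞ :=
  ∫⁻ z : EuclideanSpace ℝ (Fin N) × EuclideanSpace ℝ (Fin N),
    ENNReal.ofReal (‖v z.1 - v z.2‖ ^ p / ‖z.1 - z.2‖ ^ ((N : ℝ) + p * s)
      * (1 / ‖z.1‖ ^ (((N : ℝ) - p * s) / 2)) * (1 / ‖z.2‖ ^ (((N : ℝ) - p * s) / 2)))
    ∂((volume : Measure (EuclideanSpace ℝ (Fin N))).prod volume)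

/-- The test functions `C_0^∞(U)`: smooth complex functions on `ℝ^N` whose support is compact
and contained in `U`. -/
def IsTestFunction (N : ℕ) (U : Set (EuclideanSpace ℝ (Fin N)))
    (φ : EuclideanSpace ℝ (Fin N) → ℂ) : Prop :=
  ContDiff ℝ ∞ φ ∧ HasCompactSupport φ ∧ tsupport φ ⊆ U

/-- The homogeneous Sobolev space on `U`, i.e. the completion of `C_0^∞(U)` with respect to the
`p`-th root of `energy N s p`, realized as a space of functions on `ℝ^N`. An element of the
completion is given by a Cauchy sequence of test functions for the energy, and the function
representing it is the limit almost everywhere of that sequence. (For `U = ℝ^N` and `p s < N`, and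
for `U = ℝ^N \ {0}` and `p s > N`, each Cauchy sequence has a subsequence converging a.e., the
limit depends only on the class of the sequence, and distinct classes have distinct limits.) -/
def homogeneousSobolev (N : ℕ) (s p : ℝ) (U : Set (EuclideanSpace ℝ (Fin N))) :
    Set (EuclideanSpace ℝ (Fin N) → ℂ) :=
  {u | ∃ φ : ℕ → EuclideanSpace ℝ (Fin N) → ℂ,
    (∀ n, IsTestFunction N U (φ n)) ∧
    Tendsto (fun q : ℕ × ℕ => energy N s p (φ q.1 - φ q.2)) atTop (𝓝 0) ∧
    ∀ᵐ x, Tendsto (fun n => φ n x) atTop (𝓝 (u x))}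

/-- The surface measure `|𝕊^(d-1)|` of the unit sphere of `ℝ^d`. -/
noncomputable def sphereArea (d : ℕ) : ℝ≥0∞ :=
  (volume : Measure (EuclideanSpace ℝ (Fin d))).toSphere univ

/-- The function `Φ_{N,s,p}(r)`, `0 < r < 1`:
`|𝕊^(N-2)| ∫_{-1}^1 (1 - t²)^((N-3)/2) (1 - 2 r t + r²)^(-(N + p s)/2) dt` for `N ≥ 2`, and
`(1 - r)^(-1 - p s) + (1 + r)^(-1 - p s)` for `N = 1`. -/
noncomputable def angularKernel (N : ℕ) (s p r : ℝ) : ℝ≥0∞ :=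
  if N = 1 then
    ENNReal.ofReal (1 / (1 - r) ^ (1 + p * s) + 1 / (1 + r) ^ (1 + p * s))
  else
    sphereArea (N - 1) * ∫⁻ t in Ioo (-1 : ℝ) 1,
      ENNReal.ofReal ((1 - t ^ 2) ^ (((N : ℝ) - 3) / 2)
        / (1 - 2 * r * t + r ^ 2) ^ (((N : ℝ) + p * s) / 2))

/-- The constant `C_{N,s,p} = 2 ∫_0^1 r^(p s - 1) |1 - r^((N - p s)/p)|^p Φ_{N,s,p}(r) dr`,
as an element of `[0, ∞]`. -/
noncomputable def hardyConst (N : ℕ) (s p : ℝ) : ℝ≥0∞ :=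
  2 * ∫⁻ r in Ioo (0 : ℝ) 1,
    ENNReal.ofReal (r ^ (p * s - 1) * |1 - r ^ (((N : ℝ) - p * s) / p)| ^ p)
      * angularKernel N s p r

/-- The function `τ ↦ (1 - τ)^p - τ^p + p τ^(p-1)`. -/
noncomputable def remainderFun (p τ : ℝ) : ℝ :=
  (1 - τ) ^ p - τ ^ p + p * τ ^ (p - 1)

/-- The constant `c_p`, the infimum of `(1 - τ)^p - τ^p + p τ^(p-1)` over `0 < τ < 1/2`. -/
noncomputable def remainderConst (p : ℝ) : ℝ :=
  sInf (remainderFun p '' Ioo (0 : ℝ) (1 / 2))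

end FractionalHardy

namespace FractionalHardy

/-! The proof is a ground state representation. Put `α = (N - ps)/p`, `ω(x) = |x|^(-α)` and `u = ω
v`. For a pair with `a = ω(x) > b = ω(y)`, `z = v(x)`, `w = v(y)`, subtract `(a - b)^(p-1) (a|z|^p -
b|w|^p)` from `|u(x) - u(y)|^p = |az - bw|^p`. Each of `a|z|^p = |u(x)|^p ω(x)^(1-p)` and `b|w|^p`
depends on one point only. So the other point can be integrated out against `|x - y|^(-N-ps)`, and
by rotation and scaling the result is an exact multiple of the Hardy integral. What is left is at
least `c_p (ab)^(p/2) |z - w|^p` pointwise (`norm_mul_sub_mul_rpow_ge`), and equal to it for `p = 2`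
(`norm_mul_sub_mul_sq`).

For the pointwise bound, homogeneity and division by `z - w` reduce to a lower bound `c_p (1 - t)
t^(p/2)`, `t = b/a`, for the Jensen gap of `|·|^p` at the points `m + t`, `m + t - 1` with
barycentre `m` (`le_convexityGap`). The expansion `rpow_expansion_le`, in which `c_p` enters,
controls the gap as `t → 0` and `t → 1`, and large `m` is harmless. If the bound failed, the
quotient of the two sides would therefore have an interior minimum. But there is no critical point:
off the real axis three collinear points would be equidistant from the origin, and on it the
equations contradict the strict trapezoid inequality or the superlinearity of `x ↦ x^(p-1)`.

The one-point integrals may diverge at the diagonal, so everything is first restricted to `|y| <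
ρ|x|` with `ρ < 1`. There the constants are finite, and their difference is the truncated Hardy
constant (`outerConst_eq_add`, `innerConst_eq_add`). Monotone convergence `ρ → 1` gives
`energy_eq_add_remainder` for every measurable `u` with finite Hardy integral. Hence only the
finiteness of the energy and of the Hardy integral has to be carried to the completion, which
Fatou's lemma does. -/

/-! ### The constant `c_p`. -/

theorem continuous_remainderFun {p : ℝ} (hp : 2 ≤ p) : Continuous (remainderFun p) := by
  unfold remainderFun
  have h1 : Continuous fun τ : ℝ => (1 - τ) ^ p :=
    (continuous_const.sub continuous_id).rpow_const fun _ => Or.inr (by linarith)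
  have h2 : Continuous fun τ : ℝ => τ ^ p :=
    continuous_id.rpow_const fun _ => Or.inr (by linarith)
  have h3 : Continuous fun τ : ℝ => τ ^ (p - 1) :=
    continuous_id.rpow_const fun _ => Or.inr (by linarith)
  exact (h1.sub h2).add (continuous_const.mul h3)

theorem remainderFun_two (τ : ℝ) : remainderFun 2 τ = 1 := by
  unfold remainderFun
  norm_num
  ring

theorem hasDerivAt_remainderFun {p : ℝ} (hp : 2 ≤ p) (τ : ℝ) :
    HasDerivAt (remainderFun p)
      (-(p * (1 - τ) ^ (p - 1)) - p * τ ^ (p - 1) + p * ((p - 1) * τ ^ (p - 1 - 1))) τ := by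
  have h1 : HasDerivAt (fun τ : ℝ => (1 - τ) ^ p) (-(p * (1 - τ) ^ (p - 1))) τ := by
    have := ((hasDerivAt_id τ).const_sub 1).rpow_const (p := p) (Or.inr (by linarith))
    simpa using this
  have h2 : HasDerivAt (fun τ : ℝ => τ ^ p) (p * τ ^ (p - 1)) τ :=
    Real.hasDerivAt_rpow_const (Or.inr (by linarith))
  have h3 : HasDerivAt (fun τ : ℝ => τ ^ (p - 1)) ((p - 1) * τ ^ (p - 1 - 1)) τ :=
    Real.hasDerivAt_rpow_const (Or.inr (by linarith))
  exact (h1.sub h2).add (h3.const_mul p)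

theorem remainderFun_pos {p : ℝ} (hp : 2 ≤ p) {τ : ℝ} (h0 : 0 < τ) (h1 : τ < 1 / 2) :
    0 < remainderFun p τ := by
  unfold remainderFun
  have : τ ^ p < (1 - τ) ^ p := Real.rpow_lt_rpow h0.le (by linarith) (by linarith)
  have : 0 < p * τ ^ (p - 1) := by positivity
  linarith

theorem remainderFun_zero {p : ℝ} (hp : 2 ≤ p) : remainderFun p 0 = 1 := by
  have h1 : p ≠ 0 := by linarith
  have h2 : p - 1 ≠ 0 := by linarith
  simp [remainderFun, h1, h2]

/-- The function defining `c_p` attains its minimum over `[0, 1/2]` in the open interval. -/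
theorem exists_remainderFun_le {p : ℝ} (hp : 2 ≤ p) :
    ∃ τ₀ ∈ Ioo (0 : ℝ) (1 / 2), ∀ τ ∈ Icc (0 : ℝ) (1 / 2),
      remainderFun p τ₀ ≤ remainderFun p τ := by
  rcases hp.eq_or_lt with rfl | hp2
  -- For `p = 2` the function is constant, so any interior point serves.
  · exact ⟨1 / 4, by norm_num, fun τ _ => by simp [remainderFun_two]⟩
  obtain ⟨τ₀, hτ₀, hmin⟩ := isCompact_Icc.exists_isMinOn (s := Icc (0 : ℝ) (1 / 2))
    ⟨0, by norm_num⟩ (continuous_remainderFun hp).continuousOn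
  refine ⟨τ₀, ⟨hτ₀.1.lt_of_ne ?_, hτ₀.2.lt_of_ne ?_⟩, fun τ hτ => hmin hτ⟩
  -- For `p > 2` the derivative at `0` is `-p < 0`, so smaller values occur just to the right.
  · rintro rfl
    have hd := hasDerivAt_remainderFun hp 0
    have hs := (hasDerivWithinAt_iff_tendsto_slope' (by simp)).1 (hd.hasDerivWithinAt (s := Ioi 0))
    have hneg : -(p * (1 - 0 : ℝ) ^ (p - 1)) - p * (0 : ℝ) ^ (p - 1)
        + p * ((p - 1) * (0 : ℝ) ^ (p - 1 - 1)) < 0 := by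
      rw [Real.zero_rpow (by linarith), Real.zero_rpow (by linarith)]
      simp
      linarith
    have hev := (hs.eventually (gt_mem_nhds hneg)).and
      (Ioo_mem_nhdsGT (show (0 : ℝ) < 1 / 2 by norm_num))
    obtain ⟨τ, h1, h2⟩ := hev.exists
    have h3 := hmin (⟨h2.1.le, h2.2.le⟩ : τ ∈ Icc (0 : ℝ) (1 / 2))
    rw [slope_def_field, div_neg_iff] at h1
    simp only [mem_ofPred_eq] at h3
    rcases h1 with h1 | h1 <;> linarith [h1.1, h1.2, h2.1]
  -- The derivative at `1/2` is `p (p - 2) (1/2)^(p-2) > 0`, so smaller values occur just to the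
  -- left.
  · rintro rfl
    have hd := hasDerivAt_remainderFun hp (1 / 2)
    have hs := (hasDerivWithinAt_iff_tendsto_slope' (by simp)).1
      (hd.hasDerivWithinAt (s := Iio (1 / 2)))
    have hpos : 0 < -(p * (1 - 1 / 2 : ℝ) ^ (p - 1)) - p * (1 / 2 : ℝ) ^ (p - 1)
        + p * ((p - 1) * (1 / 2 : ℝ) ^ (p - 1 - 1)) := by
      have e1 : (1 / 2 : ℝ) ^ (p - 1) = (1 / 2 : ℝ) ^ (p - 1 - 1) * (1 / 2) := by
        rw [← Real.rpow_add_one (by norm_num)]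
        ring_nf
      have e2 : (1 - 1 / 2 : ℝ) = 1 / 2 := by norm_num
      rw [e2, e1]
      have : 0 < (1 / 2 : ℝ) ^ (p - 1 - 1) := by positivity
      have h4 : 0 < p * (p - 2) * (1 / 2 : ℝ) ^ (p - 1 - 1) := by
        have : 0 < p - 2 := by linarith
        positivity
      nlinarith
    have hev := (hs.eventually (lt_mem_nhds hpos)).and
      (Ioo_mem_nhdsLT (show (0 : ℝ) < 1 / 2 by norm_num))
    obtain ⟨τ, h1, h2⟩ := hev.exists
    have h3 := hmin (⟨h2.1.le, h2.2.le⟩ : τ ∈ Icc (0 : ℝ) (1 / 2))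
    rw [slope_def_field, div_pos_iff] at h1
    simp only [mem_ofPred_eq] at h3
    rcases h1 with h1 | h1 <;> linarith [h1.1, h1.2, h2.2]

theorem isLeast_remainderConst {p : ℝ} (hp : 2 ≤ p) :
    IsLeast (remainderFun p '' Ioo (0 : ℝ) (1 / 2)) (remainderConst p) := by
  obtain ⟨τ₀, h0, hmin⟩ := exists_remainderFun_le hp
  have : IsLeast (remainderFun p '' Ioo (0 : ℝ) (1 / 2)) (remainderFun p τ₀) := by
    refine ⟨mem_image_of_mem _ h0, ?_⟩
    rintro _ ⟨τ, hτ, rfl⟩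
    exact hmin τ (Ioo_subset_Icc_self hτ)
  unfold remainderConst
  rwa [this.csInf_eq]

theorem remainderConst_le {p : ℝ} (hp : 2 ≤ p) {τ : ℝ} (hτ : τ ∈ Icc (0 : ℝ) (1 / 2)) :
    remainderConst p ≤ remainderFun p τ := by
  obtain ⟨τ₀, h0, hmin⟩ := exists_remainderFun_le hp
  exact ((isLeast_remainderConst hp).2 (mem_image_of_mem _ h0)).trans (hmin τ hτ)

theorem remainderConst_pos {p : ℝ} (hp : 2 ≤ p) : 0 < remainderConst p := by
  obtain ⟨τ, hτ, h⟩ := (isLeast_remainderConst hp).1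
  rw [← h]
  exact remainderFun_pos hp hτ.1 hτ.2

theorem remainderConst_le_one {p : ℝ} (hp : 2 ≤ p) : remainderConst p ≤ 1 := by
  rw [← remainderFun_zero hp]
  exact remainderConst_le hp (by norm_num)

theorem remainderConst_two : remainderConst 2 = 1 := by
  obtain ⟨τ, hτ, h⟩ := (isLeast_remainderConst le_rfl).1
  rw [← h, remainderFun_two]

/-! ### Expansion of `|m + h|^p` with the remainder `c_p |h|^p`. -/

/-- The tangent line inequality for `x ↦ x ^ q`. -/
theorem rpow_tangent_le {q a b : ℝ} (hq : 1 ≤ q) (ha : 0 ≤ a) (hb : 0 ≤ b) :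
    a ^ q + q * a ^ (q - 1) * (b - a) ≤ b ^ q := by
  rcases ha.eq_or_lt with rfl | ha
  · rcases hq.eq_or_lt with rfl | hq
    · simp
    · rw [Real.zero_rpow (by linarith), Real.zero_rpow (by linarith)]
      simpa using Real.rpow_nonneg hb q
  · have hs : -1 ≤ b / a - 1 := by
      have : 0 ≤ b / a := by positivity
      linarith
    have h := one_add_mul_self_le_rpow_one_add hs hq
    have e : (1 + (b / a - 1)) ^ q = b ^ q / a ^ q := by
      rw [← Real.div_rpow hb ha.le]
      ring_nf
    have h3 : 0 < a ^ q := by positivity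
    rw [e, le_div_iff₀ h3] at h
    rw [Real.rpow_sub_one ha.ne']
    calc _ = (1 + q * (b / a - 1)) * a ^ q := by field_simp
      _ ≤ _ := h

theorem sq_rpow_eq_abs_rpow (x q : ℝ) : (x ^ 2) ^ q = |x| ^ (2 * q) := by
  rw [← sq_abs, ← Real.rpow_natCast, ← Real.rpow_mul (abs_nonneg x)]
  norm_num

/-- The expansion of `|m + h|^p` around a complex `m = x + i y` in a real direction `h`,
with the sharp remainder constant; here `p = 2 q`. -/
theorem rpow_expansion_le {q : ℝ} (hq : 1 ≤ q) (x y h : ℝ) :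
    (x ^ 2 + y ^ 2) ^ q + 2 * q * (x ^ 2 + y ^ 2) ^ (q - 1) * (x * h)
      + remainderConst (2 * q) * (h ^ 2) ^ q ≤ ((x + h) ^ 2 + y ^ 2) ^ q := by
  have hp : (2 : ℝ) ≤ 2 * q := by linarith
  set c := remainderConst (2 * q) with hc
  have hc0 : 0 < c := remainderConst_pos hp
  set n := x ^ 2 + y ^ 2 with hn
  have hn0 : 0 ≤ n := by positivity
  set B := (x + h) ^ 2 + y ^ 2 with hB
  have hB0 : 0 ≤ B := by positivity
  have hBn : B - n = 2 * (x * h) + h ^ 2 := by simp only [hB, hn]; ring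
  -- The threshold `|h| = 2|m|` is where `τ = |m|/|h|` equals `1/2`, the end of the range defining
  -- `c_p`. Below it the quadratic term `q n^(q-1) h²` of the tangent line at `n` absorbs the
  -- remainder, because `c_p` is at most the value `p (1/2)^(p-1)` at `τ = 1/2`.
  rcases le_or_gt (h ^ 2) (4 * n) with hcase | hcase
  · have h1 := rpow_tangent_le hq hn0 hB0
    rw [hBn] at h1
    have hc1 : c ≤ 2 * q * (1 / 2) ^ (2 * q - 1) := by
      have := remainderConst_le hp (τ := 1 / 2) (by norm_num)
      unfold remainderFun at this
      norm_num at this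
      norm_num
      linarith
    have e1 : (1 / 2 : ℝ) ^ (2 * q - 1) * 4 ^ (q - 1) = 1 / 2 := by
      have : (4 : ℝ) = (1 / 2 : ℝ) ^ (-2 : ℝ) := by
        rw [Real.rpow_neg (by norm_num)]
        norm_num
      rw [this, ← Real.rpow_mul (by norm_num), ← Real.rpow_add (by norm_num)]
      ring_nf
      norm_num
    have h2 : (h ^ 2) ^ (q - 1) ≤ 4 ^ (q - 1) * n ^ (q - 1) := by
      rw [← Real.mul_rpow (by norm_num) hn0]
      exact Real.rpow_le_rpow (by positivity) hcase (by linarith)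
    have h3 : c * (h ^ 2) ^ q ≤ q * n ^ (q - 1) * h ^ 2 := by
      rcases eq_or_ne h 0 with rfl | hh
      · rw [zero_pow two_ne_zero, Real.zero_rpow (by linarith)]
        simp
      have e2 : (h ^ 2) ^ q = (h ^ 2) ^ (q - 1) * h ^ 2 := by
        rw [← Real.rpow_add_one (by positivity)]
        ring_nf
      rw [e2, ← mul_assoc]
      refine mul_le_mul_of_nonneg_right ?_ (sq_nonneg h)
      calc c * (h ^ 2) ^ (q - 1)
          ≤ (2 * q * (1 / 2) ^ (2 * q - 1)) * (4 ^ (q - 1) * n ^ (q - 1)) := by gcongr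
        _ = 2 * q * ((1 / 2 : ℝ) ^ (2 * q - 1) * 4 ^ (q - 1)) * n ^ (q - 1) := by ring
        _ = q * n ^ (q - 1) := by rw [e1]; ring
    linarith
  · set r := √n with hr
    have hr0 : 0 ≤ r := Real.sqrt_nonneg _
    have hrn : r ^ 2 = n := Real.sq_sqrt hn0
    set k := |h| with hk
    have hkk : k ^ 2 = h ^ 2 := sq_abs h
    have hk0 : 0 < k := by
      rw [hk, abs_pos]
      rintro rfl
      nlinarith
    have hrk : 2 * r < k := by
      nlinarith
    have hxr : |x| ≤ r := Real.abs_le_sqrt (by simp only [hn]; nlinarith [sq_nonneg y])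
    have hxh : -(r * k) ≤ x * h := by
      have : |x * h| ≤ r * k := by
        rw [abs_mul]
        gcongr
      exact (abs_le.1 this).1
    -- `(k - r)²` is the least possible value of `B = |m + h|²`, taken when `m` and `h` are
    -- antiparallel. As `B` lies above it and `k - r > r`, the slope of the tangent there may be
    -- lowered to `q n^(q-1)`. What remains is the inequality defining `c_p` at `τ = r/k`.
    have h1 := rpow_tangent_le hq (sq_nonneg (k - r)) hB0
    have hs : 0 ≤ B - (k - r) ^ 2 := by nlinarith
    have h2 : n ^ (q - 1) ≤ ((k - r) ^ 2) ^ (q - 1) := by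
      apply Real.rpow_le_rpow hn0 _ (by linarith)
      nlinarith
    have h3 : q * n ^ (q - 1) * (B - (k - r) ^ 2)
        ≤ q * ((k - r) ^ 2) ^ (q - 1) * (B - (k - r) ^ 2) := by gcongr
    have h4 := remainderConst_le hp (τ := r / k)
      ⟨by positivity, by rw [div_le_iff₀ hk0]; linarith⟩
    rw [← hc] at h4
    have h5 : c * k ^ (2 * q) ≤ (k - r) ^ (2 * q) - r ^ (2 * q) + 2 * q * r ^ (2 * q - 1) * k := by
      have hkp : 0 < k ^ (2 * q) := by positivity
      calc c * k ^ (2 * q) ≤ remainderFun (2 * q) (r / k) * k ^ (2 * q) := by gcongr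
        _ = _ := by
          unfold remainderFun
          have e1 : 1 - r / k = (k - r) / k := by field_simp
          rw [e1, Real.div_rpow (by linarith) hk0.le, Real.div_rpow hr0 hk0.le,
            Real.div_rpow hr0 hk0.le, Real.rpow_sub_one hk0.ne' (2 * q)]
          field_simp
    have e1 : ((k - r) ^ 2) ^ q = (k - r) ^ (2 * q) := by
      rw [sq_rpow_eq_abs_rpow, abs_of_nonneg (by linarith)]
    have e2 : n ^ q = r ^ (2 * q) := by
      rw [← hrn, sq_rpow_eq_abs_rpow, abs_of_nonneg hr0]
    have e3 : (h ^ 2) ^ q = k ^ (2 * q) := by rw [sq_rpow_eq_abs_rpow]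
    have e4 : n ^ (q - 1) * r = r ^ (2 * q - 1) := by
      rcases hr0.eq_or_lt with h0 | h0
      · rw [← h0, Real.zero_rpow (by linarith), mul_zero]
      · rw [← hrn, sq_rpow_eq_abs_rpow, abs_of_nonneg hr0, ← Real.rpow_add_one h0.ne']
        ring_nf
    rw [e1] at h1
    rw [e3, e2]
    rw [← e4] at h5
    have e5 : B - (k - r) ^ 2 = 2 * (x * h) + 2 * r * k := by
      have : B = n + 2 * (x * h) + h ^ 2 := by linarith
      rw [this, ← hrn, ← hkk]; ring
    rw [e5] at h3 h1
    nlinarith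

/-! ### Absence of critical points for the convexity gap. -/

theorem mul_rpow_le_mul_rpow {Q u v : ℝ} (hQ : 1 ≤ Q) (hu : 0 < u) (huv : u ≤ v) :
    v * u ^ Q ≤ u * v ^ Q := by
  have hv := hu.trans_le huv
  have e : ∀ w : ℝ, 0 < w → w ^ Q = w * w ^ (Q - 1) := fun w hw => by
    rw [Real.rpow_sub_one hw.ne']; field_simp
  have h : u ^ (Q - 1) ≤ v ^ (Q - 1) := Real.rpow_le_rpow hu.le huv (by linarith)
  rw [e u hu, e v hv]
  nlinarith [mul_le_mul_of_nonneg_left h (mul_pos hu hv).le]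

theorem mul_rpow_lt_mul_rpow {Q u v : ℝ} (hQ : 1 < Q) (hu : 0 < u) (huv : u < v) :
    v * u ^ Q < u * v ^ Q := by
  have hv := hu.trans huv
  have e : ∀ w : ℝ, 0 < w → w ^ Q = w * w ^ (Q - 1) := fun w hw => by
    rw [Real.rpow_sub_one hw.ne']; field_simp
  have h : u ^ (Q - 1) < v ^ (Q - 1) := Real.rpow_lt_rpow hu.le huv (by linarith)
  rw [e u hu, e v hv]
  nlinarith [mul_lt_mul_of_pos_left h (mul_pos hu hv)]

/-- The strict trapezoid inequality for `x ↦ x ^ Q` on `[ν, 1]`. -/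
theorem one_sub_rpow_lt_trapezoid {Q ν : ℝ} (hQ : 1 < Q) (h0 : 0 ≤ ν) (h1 : ν < 1) :
    1 - ν ^ (Q + 1) < (Q + 1) / 2 * (1 - ν) * (1 + ν ^ Q) := by
  let h : ℝ → ℝ := fun x => (Q + 1) / 2 * (1 - x) * (1 + x ^ Q) - 1 + x ^ (Q + 1)
  have hd : ∀ x, HasDerivAt h ((Q + 1) / 2 * (-1) * (1 + x ^ Q)
      + (Q + 1) / 2 * (1 - x) * (Q * x ^ (Q - 1)) + (Q + 1) * x ^ (Q + 1 - 1)) x := by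
    intro x
    have e1 := ((hasDerivAt_id x).const_sub 1).const_mul ((Q + 1) / 2)
    have e2 := (Real.hasDerivAt_rpow_const (x := x) (p := Q) (Or.inr hQ.le)).const_add 1
    have e3 := Real.hasDerivAt_rpow_const (x := x) (p := Q + 1) (Or.inr (by linarith))
    exact ((e1.mul e2).sub_const 1).add e3
  -- The difference `h` of the two sides vanishes at `1`, and `h' < 0` is Bernoulli's inequality at
  -- `1/x`.
  have hanti : StrictAntiOn h (Icc 0 1) := by
    apply strictAntiOn_of_deriv_neg (convex_Icc 0 1)
    · exact fun x _ => (hd x).continuousAt.continuousWithinAt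
    · intro x hx
      rw [interior_Icc] at hx
      rw [(hd x).deriv]
      have hs : -1 ≤ 1 / x - 1 := by
        have : 0 < 1 / x := by have := hx.1; positivity
        linarith
      have hs' : 1 / x - 1 ≠ 0 := by
        have : 1 < 1 / x := by rw [lt_div_iff₀ hx.1]; linarith [hx.2]
        linarith
      have hb := one_add_mul_self_lt_rpow_one_add hs hs' hQ
      have hxQ : 0 < x ^ Q := Real.rpow_pos_of_pos hx.1 _
      have e : (1 + (1 / x - 1)) ^ Q = 1 / x ^ Q := by
        rw [show 1 + (1 / x - 1) = 1 / x by ring, Real.div_rpow zero_le_one hx.1.le,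
          Real.one_rpow]
      rw [e, lt_div_iff₀ hxQ] at hb
      rw [show Q + 1 - 1 = Q by ring, Real.rpow_sub_one hx.1.ne']
      have hx0 := hx.1.ne'
      have : (Q + 1) / 2 * (-1) * (1 + x ^ Q) + (Q + 1) / 2 * (1 - x) * (Q * (x ^ Q / x))
          + (Q + 1) * x ^ Q = (Q + 1) / 2 * ((1 + Q * (1 / x - 1)) * x ^ Q - 1) := by
        field_simp
        ring
      rw [this]
      nlinarith
  have := hanti ⟨h0, h1.le⟩ (right_mem_Icc.2 zero_le_one) h1
  simp only [h, sub_self, mul_zero, zero_mul, Real.one_rpow] at this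
  linarith

/-- The critical point equations for the convexity gap on the real line are incompatible. -/
theorem false_of_critical_real {Q t x α β P R M : ℝ} (hQ : 1 < Q) (ht1 : t < 1)
    (ht0 : 0 < t) (hβ : 0 < β) (hαβ : α + β = 1) (hx : x = α - t)
    (hP : P = α ^ Q) (hR : R = β ^ Q) (hM : M = SignType.sign x * |x| ^ Q)
    (hcrit : (1 - t) * P - t * R = M)
    (hder : -(α * P) + β * R + (Q + 1) * M = (P + R) * ((Q + 1) / 2 * (1 - t) - t)) : False := by
  have hβx : β + x = 1 - t := by linarith
  -- Elimination of `P` from the two equations. For `x = -μ ≤ 0` this says that the trapezoid rule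
  -- for the `Q`-th power is exact on `[μ, β]`, which strict convexity forbids.
  have key : β * R - x * M = (Q + 1) / 2 * (β + x) * (R - M) := by
    have h1 : (1 - t) * (P + R) = R + M := by linarith
    have h2 : (t - α) * (P + R) + R = (Q + 1) / 2 * (R - M) := by
      have : β = 1 - α := by linarith
      subst this
      have : (P + R) * ((Q + 1) / 2 * (1 - t) - t)
        = (Q + 1) / 2 * ((1 - t) * (P + R)) - t * (P + R) := by ring
      rw [this, h1] at hder
      linarith
    have h3 : (1 - t) * ((t - α) * (P + R) + R) = (1 - t) * ((Q + 1) / 2 * (R - M)) := by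
      rw [h2]
    have h4 : (t - α) * ((1 - t) * (P + R)) + (1 - t) * R
        = (Q + 1) / 2 * (1 - t) * (R - M) := by linarith
    rw [h1] at h4
    rw [hβx, ← h4, hx]
    have : β = 1 - α := by linarith
    rw [this]; ring
  have hR0 : 0 < R := by rw [hR]; positivity
  rcases le_or_gt x 0 with hx0 | hx0
  · set μ := -x with hμ
    have hM' : M = -μ ^ Q := by
      rcases hx0.eq_or_lt with h | h
      · have hμ0 : μ = 0 := by simp [hμ, h]
        rw [hM, h, hμ0, Real.zero_rpow (by linarith)]
        simp
      · rw [hM, sign_neg h, abs_of_neg h]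
        simp [hμ]
    have hμβ : μ < β := by linarith
    have htr := one_sub_rpow_lt_trapezoid hQ (ν := μ / β)
      (div_nonneg (by linarith) hβ.le) (by rw [div_lt_one hβ]; exact hμβ)
    have hμ0 : 0 ≤ μ := by linarith
    have e1 : μ ^ (Q + 1) = μ * μ ^ Q := by
      rcases hμ0.eq_or_lt with h | h
      · rw [← h, Real.zero_rpow (by linarith), zero_mul]
      · rw [Real.rpow_add_one h.ne']; ring
    rw [Real.div_rpow hμ0 hβ.le, Real.div_rpow hμ0 hβ.le, e1, Real.rpow_add_one hβ.ne',
      ← hR] at htr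
    have h5 : (1 - μ * μ ^ Q / (R * β)) * (R * β)
        < (Q + 1) / 2 * (1 - μ / β) * (1 + μ ^ Q / R) * (R * β) :=
      mul_lt_mul_of_pos_right htr (by positivity)
    have h6 : (1 - μ * μ ^ Q / (R * β)) * (R * β) = β * R - x * M := by
      rw [hM']; field_simp; simp only [hμ]; ring
    have h7 : (Q + 1) / 2 * (1 - μ / β) * (1 + μ ^ Q / R) * (R * β)
        = (Q + 1) / 2 * (β + x) * (R - M) := by
      rw [hM']; field_simp; simp only [hμ]; ring
    rw [h6, h7] at h5
    exact h5.ne key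
  · have hM' : M = x ^ Q := by
      rw [hM, sign_pos hx0, abs_of_pos hx0]
      simp
    have hM0 : 0 < M := by rw [hM']; positivity
    have hxα : x < α := by linarith
    -- If `β ≤ x < α`, the monotonicity of `w^Q / w` compares `M` with `P` and `R`, and inserting
    -- this in the first equation gives `(β + x) α M < (β + x) α M`.
    have hxβ : x < β := by
      by_contra! hle
      have h1 : α * M < x * P := by
        rw [hM', hP]; exact mul_rpow_lt_mul_rpow hQ hx0 hxα
      have h2 : x * R ≤ β * M := by
        rw [hM', hR]; exact mul_rpow_le_mul_rpow hQ.le hβ hle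
      have h3 : (β + x) * P = R * (α - x) + M * (α + β) := by
        rw [hβx, hαβ, hx]
        linarith
      have h4 : (β + x) * (α * M) < (β + x) * (x * P) :=
        mul_lt_mul_of_pos_left h1 (by linarith)
      have h5 : (β + x) * (x * P) = x * (R * (α - x) + M * (α + β)) := by rw [← h3]; ring
      have h6 : x * R * (α - x) ≤ β * M * (α - x) :=
        mul_le_mul_of_nonneg_right h2 (by linarith)
      nlinarith
    -- Now `β R - x M ≤ (β + x)(R - M)`, while `key` puts the factor `(Q + 1)/2 > 1` in front of the
    -- same positive quantity.
    have h1 : β * M ≤ x * R := by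
      rw [hM', hR]; exact mul_rpow_le_mul_rpow hQ.le hx0 hxβ.le
    have h2 : M < R := by
      rw [hM', hR]; exact Real.rpow_lt_rpow hx0.le hxβ (by linarith)
    have h3 : 0 < (β + x) * (R - M) := mul_pos (by linarith) (by linarith)
    nlinarith

/-- The derivative of `|z|^(2q) / (2q)` along the real line. -/
noncomputable def oddPow (q z : ℝ) : ℝ := z * (z ^ 2) ^ (q - 1)

theorem oddPow_of_nonneg {q z : ℝ} (hq : 1 < q) (hz : 0 ≤ z) : oddPow q z = z ^ (2 * q - 1) := by
  unfold oddPow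
  rcases hz.eq_or_lt with rfl | hz
  · rw [Real.zero_rpow (by linarith), zero_mul]
  · rw [sq_rpow_eq_abs_rpow, abs_of_pos hz, mul_comm, ← Real.rpow_add_one hz.ne']
    ring_nf

theorem oddPow_neg (q z : ℝ) : oddPow q (-z) = -oddPow q z := by
  simp [oddPow]

theorem sq_rpow_eq_mul_oddPow {q : ℝ} (hq : 1 < q) (z : ℝ) : (z ^ 2) ^ q = z * oddPow q z := by
  rcases eq_or_ne z 0 with rfl | hz
  · simp [show q ≠ 0 by linarith]
  · unfold oddPow
    rw [Real.rpow_sub_one (by positivity)]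
    field_simp

theorem oddPow_eq_sign {q : ℝ} (hq : 1 < q) (z : ℝ) :
    oddPow q z = SignType.sign z * |z| ^ (2 * q - 1) := by
  rcases lt_trichotomy z 0 with h | rfl | h
  · rw [sign_neg h, abs_of_neg h, ← oddPow_of_nonneg hq (by linarith), oddPow_neg]
    simp
  · simp [oddPow]
  · rw [sign_pos h, abs_of_pos h, ← oddPow_of_nonneg hq h.le]
    simp

theorem oddPow_lt {q t A B : ℝ} (hq : 1 < q) (ht0 : 0 < t) (ht1 : t < 1) (hA : 0 ≤ A)
    (hB : 0 ≤ B) (hAB : A ≠ B) :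
    oddPow q ((1 - t) * A + t * B) < (1 - t) * oddPow q A + t * oddPow q B := by
  have h1 : 0 < 1 - t := by linarith
  have := (strictConvexOn_rpow (p := 2 * q - 1) (by linarith)).2 (mem_Ici.2 hA) (mem_Ici.2 hB) hAB
    h1 ht0 (by ring)
  rw [oddPow_of_nonneg hq hA, oddPow_of_nonneg hq hB, oddPow_of_nonneg hq (by positivity)]
  simpa using this

/-- The critical point equations for the convexity gap in the plane are incompatible. -/
theorem false_of_critical {q t x y a b n g : ℝ} (hq : 1 < q) (ht0 : 0 < t) (ht1 : t < 1)
    (ha : a = ((x + t) ^ 2 + y ^ 2) ^ (q - 1)) (hb : b = ((x - 1 + t) ^ 2 + y ^ 2) ^ (q - 1))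
    (hn : n = (x ^ 2 + y ^ 2) ^ (q - 1))
    (hg : g = (1 - t) * ((x + t) ^ 2 + y ^ 2) ^ q + t * ((x - 1 + t) ^ 2 + y ^ 2) ^ q
      - (x ^ 2 + y ^ 2) ^ q)
    (hcx : (1 - t) * ((x + t) * a) + t * ((x - 1 + t) * b) = x * n)
    (hcy : (1 - t) * (y * a) + t * (y * b) = y * n)
    (hct : t * (1 - t) * (-((x + t) ^ 2 + y ^ 2) ^ q + ((x - 1 + t) ^ 2 + y ^ 2) ^ q
      + 2 * q * ((1 - t) * ((x + t) * a) + t * ((x - 1 + t) * b))) = g * (q * (1 - t) - t)) :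
    False := by
  rcases eq_or_ne y 0 with rfl | hy
  · have e : ∀ z : ℝ, z ^ 2 + 0 ^ 2 = z ^ 2 := fun z => by ring
    simp only [e] at *
    have hcrit : (1 - t) * oddPow q (x + t) + t * oddPow q (x - 1 + t) = oddPow q x := by
      simp only [oddPow]
      rw [← ha, ← hb, ← hn]
      exact hcx
    -- Otherwise `x + t`, `x + t - 1` and their barycentre `x` lie on one half-line, where strict
    -- Jensen for the odd power contradicts `hcrit`. The same argument places `x - 1 + t` on the
    -- negative side.
    have hA : 0 < x + t := by
      by_contra! hA
      have := oddPow_lt hq ht0 ht1 (A := -(x + t)) (B := -(x - 1 + t)) (by linarith)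
        (by linarith) (by intro h; linarith)
      rw [show (1 - t) * -(x + t) + t * -(x - 1 + t) = -x by ring, oddPow_neg, oddPow_neg,
        oddPow_neg] at this
      linarith
    have hB : 0 < -(x - 1 + t) := by
      by_contra! hB
      have := oddPow_lt hq ht0 ht1 (A := x + t) (B := x - 1 + t) (by linarith)
        (by linarith) (by intro h; linarith)
      rw [show (1 - t) * (x + t) + t * (x - 1 + t) = x by ring] at this
      linarith
    have hPA := oddPow_of_nonneg hq hA.le
    have hRB := oddPow_of_nonneg hq hB.le
    have eB : oddPow q (x - 1 + t) = -oddPow q (-(x - 1 + t)) := by rw [oddPow_neg]; ring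
    refine false_of_critical_real (Q := 2 * q - 1) (by linarith) ht1 ht0 hB (by ring)
      (by ring) hPA hRB (oddPow_eq_sign hq x) ?_ ?_
    · rw [eB] at hcrit
      linarith
    · rw [sq_rpow_eq_mul_oddPow hq, sq_rpow_eq_mul_oddPow hq, hcx] at hct
      rw [sq_rpow_eq_mul_oddPow hq, sq_rpow_eq_mul_oddPow hq, sq_rpow_eq_mul_oddPow hq] at hg
      have hxn : x * n = oddPow q x := by rw [hn]; rfl
      rw [hxn, eB] at hct
      rw [eB] at hg hcrit
      set P := oddPow q (x + t)
      set R := oddPow q (-(x - 1 + t))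
      set M := oddPow q x
      have hgt : g = t * (1 - t) * (P + R) := by
        rw [hg, ← hcrit]; ring
      rw [hgt] at hct
      have h0 : t * (1 - t) ≠ 0 := mul_ne_zero ht0.ne' (by linarith)
      have h1 := mul_left_cancel₀ h0 (hct.trans (mul_assoc _ _ _))
      linarith
  -- Off the real axis the equations in `x` and `y` force `a = b = n`. Then three distinct points of
  -- a horizontal line have equal modulus.
  · have h1 : (1 - t) * a + t * b = n := by
      have : y * ((1 - t) * a + t * b) = y * n := by rw [← hcy]; ring
      exact mul_left_cancel₀ hy this
    have h2 : a = b := by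
      rw [← h1] at hcx
      have h0 : t * (1 - t) ≠ 0 := mul_ne_zero ht0.ne' (by linarith)
      have : t * (1 - t) * a = t * (1 - t) * b := by linarith
      exact mul_left_cancel₀ h0 this
    have h3 : a = n := by rw [← h1, ← h2]; ring
    have hinj : ∀ u v : ℝ, 0 ≤ u → 0 ≤ v → u ^ (q - 1) = v ^ (q - 1) → u = v :=
      fun u v hu hv h => (Real.rpow_left_inj hu hv (by linarith)).1 h
    have h4 := hinj _ _ (by positivity) (by positivity) (ha.symm.trans (h2.trans hb))
    have h5 := hinj _ _ (by positivity) (by positivity) (ha.symm.trans (h3.trans hn))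
    have h6 : x = 1 / 2 - t := by linarith
    rw [h6] at h5
    nlinarith

/-! ### Lower bounds for the convexity gap. -/

/-- The convexity gap of `|z|^(2q)` at `z = x + iy`, between the points `z + t` and `z + t - 1`. -/
noncomputable def convexityGap (q t x y : ℝ) : ℝ :=
  (1 - t) * ((x + t) ^ 2 + y ^ 2) ^ q + t * ((x - 1 + t) ^ 2 + y ^ 2) ^ q - (x ^ 2 + y ^ 2) ^ q

/-- Expand around the barycentre with increments `t` and `t - 1`: the linear terms cancel under the
weights `1 - t` and `t`. This is the estimate that is sharp enough near `t = 0` and `t = 1`. -/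
theorem mul_sq_rpow_le_convexityGap {q t : ℝ} (hq : 1 ≤ q) (ht0 : 0 < t) (ht1 : t < 1) (x y : ℝ) :
    remainderConst (2 * q) * ((1 - t) * t ^ (2 * q) + t * (1 - t) ^ (2 * q))
      ≤ convexityGap q t x y := by
  have h1 := rpow_expansion_le hq x y t
  have h2 := rpow_expansion_le hq x y (t - 1)
  have e2 : x + (t - 1) = x - 1 + t := by ring
  rw [sq_rpow_eq_abs_rpow, abs_of_pos ht0] at h1
  rw [sq_rpow_eq_abs_rpow, abs_of_neg (by linarith), e2, neg_sub] at h2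
  unfold convexityGap
  have h3 := mul_le_mul_of_nonneg_left h1 (show 0 ≤ 1 - t by linarith)
  have h4 := mul_le_mul_of_nonneg_left h2 ht0.le
  linarith

/-- The tangent line at `|z|²` keeps the second order term, which grows with `|z|`. This confines
possible counterexamples to the unit disc. -/
theorem mul_rpow_le_convexityGap {q t : ℝ} (hq : 1 ≤ q) (ht0 : 0 < t) (ht1 : t < 1) (x y : ℝ) :
    q * (x ^ 2 + y ^ 2) ^ (q - 1) * (t * (1 - t)) ≤ convexityGap q t x y := by
  have h1 := rpow_tangent_le hq (a := x ^ 2 + y ^ 2) (b := (x + t) ^ 2 + y ^ 2)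
    (by positivity) (by positivity)
  have h2 := rpow_tangent_le hq (a := x ^ 2 + y ^ 2) (b := (x - 1 + t) ^ 2 + y ^ 2)
    (by positivity) (by positivity)
  unfold convexityGap
  have h3 := mul_le_mul_of_nonneg_left h1 (show 0 ≤ 1 - t by linarith)
  have h4 := mul_le_mul_of_nonneg_left h2 ht0.le
  have e : q * (x ^ 2 + y ^ 2) ^ (q - 1) * (t * (1 - t))
    = (1 - t) * (q * (x ^ 2 + y ^ 2) ^ (q - 1) * ((x + t) ^ 2 + y ^ 2 - (x ^ 2 + y ^ 2)))
      + t * (q * (x ^ 2 + y ^ 2) ^ (q - 1) * ((x - 1 + t) ^ 2 + y ^ 2 - (x ^ 2 + y ^ 2))) := by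
    ring
  linarith

theorem hasDerivAt_rpow_comp {q : ℝ} (hq : 1 ≤ q) {f : ℝ → ℝ} {f' z : ℝ} (hf : HasDerivAt f f' z) :
    HasDerivAt (fun z => f z ^ q) (q * f z ^ (q - 1) * f') z := by
  convert! hf.rpow_const (p := q) (Or.inr hq) using 1
  ring

/-- The sharp lower bound for the convexity gap. -/
theorem le_convexityGap {q t₀ : ℝ} (hq : 1 < q) (ht0 : 0 < t₀) (ht1 : t₀ < 1) (x₀ y₀ : ℝ) :
    remainderConst (2 * q) * ((1 - t₀) * t₀ ^ q) ≤ convexityGap q t₀ x₀ y₀ := by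
  by_contra! hlt
  have hp : (2 : ℝ) ≤ 2 * q := by linarith
  set c := remainderConst (2 * q) with hc
  have hc0 : 0 < c := remainderConst_pos hp
  have hc1 : c ≤ 1 := remainderConst_le_one hp
  have hw : ∀ t : ℝ, 0 < t → t < 1 → 0 < (1 - t) * t ^ q := fun t h0 h1 =>
    mul_pos (by linarith) (by positivity)
  -- `H` is the quotient to be bounded below by `c`. The next three bounds show that values below
  -- `c` stay in the disc, that `H` is asymptotically at least `c` as `t → 1`, and that it blows up
  -- as `t → 0`.
  let H : ℝ × ℝ × ℝ → ℝ := fun z => convexityGap q z.1 z.2.1 z.2.2 / ((1 - z.1) * z.1 ^ q)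
  set κ := H (t₀, x₀, y₀) with hκ
  have hκc : κ < c := by
    rw [hκ]
    exact (div_lt_iff₀ (hw t₀ ht0 ht1)).2 hlt
  have hb1 : ∀ t x y, 0 < t → t < 1 → c * t ^ q ≤ H (t, x, y) := by
    intro t x y h0 h1
    rw [le_div_iff₀ (hw t h0 h1)]
    refine le_trans ?_ (mul_sq_rpow_le_convexityGap hq.le h0 h1 x y)
    have e : t ^ (2 * q) = t ^ q * t ^ q := by
      rw [two_mul, Real.rpow_add h0]
    have h2 : 0 ≤ t * (1 - t) ^ (2 * q) := mul_nonneg h0.le (Real.rpow_nonneg (by linarith) _)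
    simp only [e]
    nlinarith
  have hb2 : ∀ t x y, 0 < t → t < 1 → c * (1 - t) ^ (2 * q - 1) ≤ H (t, x, y) * t ^ (q - 1) := by
    intro t x y h0 h1
    have h2 := mul_sq_rpow_le_convexityGap hq.le h0 h1 x y
    have h3 : 0 ≤ (1 - t) * t ^ (2 * q) := mul_nonneg (by linarith) (Real.rpow_nonneg h0.le _)
    have h4 : c * (t * (1 - t) ^ (2 * q)) ≤ convexityGap q t x y := by nlinarith
    have h5 : H (t, x, y) * t ^ (q - 1) = convexityGap q t x y / (t * (1 - t)) := by
      simp only [H]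
      rw [Real.rpow_sub_one h0.ne']
      have : t ^ q ≠ 0 := by positivity
      have : 1 - t ≠ 0 := by linarith
      field_simp
    rw [h5, le_div_iff₀ (mul_pos h0 (by linarith)), Real.rpow_sub_one (by linarith)]
    refine le_trans (le_of_eq ?_) h4
    have : 1 - t ≠ 0 := by linarith
    field_simp
  have hb3 : ∀ t x y, 0 < t → t < 1 → H (t, x, y) < c → x ^ 2 + y ^ 2 < 1 := by
    intro t x y h0 h1 h
    by_contra! hn
    have h2 := mul_rpow_le_convexityGap hq.le h0 h1 x y
    have h3 : 1 ≤ (x ^ 2 + y ^ 2) ^ (q - 1) := Real.one_le_rpow hn (by linarith)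
    have h4 : t ^ q ≤ t := by
      have := Real.rpow_le_rpow_of_exponent_ge h0 h1.le hq.le
      simpa using this
    rw [div_lt_iff₀ (hw t h0 h1)] at h
    have h5 : 1 ≤ q * (x ^ 2 + y ^ 2) ^ (q - 1) := by nlinarith
    have h6 : 0 ≤ t * (1 - t) := mul_nonneg h0.le (by linarith)
    have h7 : c * ((1 - t) * t ^ q) ≤ 1 * ((1 - t) * t) :=
      mul_le_mul hc1 (mul_le_mul_of_nonneg_left h4 (by linarith)) (hw t h0 h1).le zero_le_one
    nlinarith
  -- `t₁` and `t₂` are chosen so that `H > κ` on the faces `t = t₁` and `t = t₂` of the box `K`.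
  -- Points with `|x| = 1` or `|y| = 1` are excluded by `hb3`, so the minimum over `K` is interior.
  obtain ⟨t₂, ht₂, ht₂'⟩ : ∃ t, t ∈ Ioo t₀ 1 ∧ κ < c * t ^ q := by
    have hcont : Tendsto (fun t : ℝ => c * t ^ q) (𝓝[<] 1) (𝓝 (c * 1 ^ q)) :=
      ((Real.continuousAt_rpow_const 1 q (Or.inl one_ne_zero)).const_mul c).tendsto.mono_left
        nhdsWithin_le_nhds
    rw [Real.one_rpow, mul_one] at hcont
    exact (Eventually.and (Ioo_mem_nhdsLT ht1) (hcont.eventually (lt_mem_nhds hκc))).exists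
  obtain ⟨t₁, ht₁, ht₁'⟩ : ∃ t, t ∈ Ioo 0 t₀ ∧ 0 < c * (1 - t) ^ (2 * q - 1) - κ * t ^ (q - 1) := by
    have hcont : Tendsto (fun t : ℝ => c * (1 - t) ^ (2 * q - 1) - κ * t ^ (q - 1)) (𝓝[>] 0)
        (𝓝 (c * (1 - 0) ^ (2 * q - 1) - κ * 0 ^ (q - 1))) := by
      have h1 : Continuous fun t : ℝ => (1 - t) ^ (2 * q - 1) :=
        (continuous_const.sub continuous_id).rpow_const fun _ => Or.inr (by linarith)
      have h2 : Continuous fun t : ℝ => t ^ (q - 1) :=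
        continuous_id.rpow_const fun _ => Or.inr (by linarith)
      exact ((continuous_const.mul h1).sub (continuous_const.mul h2)).continuousAt.tendsto.mono_left
        nhdsWithin_le_nhds
    rw [Real.zero_rpow (by linarith), sub_zero, Real.one_rpow, mul_one, mul_zero, sub_zero] at hcont
    exact (Eventually.and (Ioo_mem_nhdsGT ht0) (hcont.eventually (lt_mem_nhds hc0))).exists
  set K : Set (ℝ × ℝ × ℝ) := Icc t₁ t₂ ×ˢ Icc (-1) 1 ×ˢ Icc (-1) 1 with hK
  have hKc : IsCompact K := isCompact_Icc.prod (isCompact_Icc.prod isCompact_Icc)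
  have hcontK : ContinuousOn H K := by
    apply ContinuousOn.div
    · apply Continuous.continuousOn
      unfold convexityGap
      have hr : ∀ f : ℝ × ℝ × ℝ → ℝ, Continuous f → Continuous fun z => f z ^ q :=
        fun f hf => hf.rpow_const fun _ => Or.inr (by linarith)
      have h1 := hr (fun z => (z.2.1 + z.1) ^ 2 + z.2.2 ^ 2) (by fun_prop)
      have h2 := hr (fun z => (z.2.1 - 1 + z.1) ^ 2 + z.2.2 ^ 2) (by fun_prop)
      have h3 := hr (fun z => z.2.1 ^ 2 + z.2.2 ^ 2) (by fun_prop)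
      fun_prop
    · exact ((continuous_const.sub continuous_fst).mul
        (continuous_fst.rpow_const fun _ => Or.inr (by linarith))).continuousOn
    · intro z hz
      exact (hw z.1 (ht₁.1.trans_le hz.1.1) (hz.1.2.trans_lt ht₂.2)).ne'
  have hxy : ∀ x y : ℝ, x ^ 2 + y ^ 2 < 1 → x ∈ Ioo (-1 : ℝ) 1 ∧ y ∈ Ioo (-1 : ℝ) 1 := by
    intro x y h
    exact ⟨abs_lt.1 ((sq_lt_one_iff_abs_lt_one x).1 (by nlinarith [sq_nonneg y])),
      abs_lt.1 ((sq_lt_one_iff_abs_lt_one y).1 (by nlinarith [sq_nonneg x]))⟩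
  have hz₀ : (t₀, x₀, y₀) ∈ K := by
    obtain ⟨h1, h2⟩ := hxy _ _ (hb3 t₀ x₀ y₀ ht0 ht1 hκc)
    exact ⟨⟨ht₁.2.le, ht₂.1.le⟩, Ioo_subset_Icc_self h1, Ioo_subset_Icc_self h2⟩
  obtain ⟨⟨t, x, y⟩, hzK, hmin⟩ := hKc.exists_isMinOn ⟨_, hz₀⟩ hcontK
  have hle : H (t, x, y) ≤ κ := hmin hz₀
  have htpos : 0 < t := ht₁.1.trans_le hzK.1.1
  have htlt : t < 1 := hzK.1.2.trans_lt ht₂.2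
  obtain ⟨hx, hy⟩ := hxy _ _ (hb3 t x y htpos htlt (hle.trans_lt hκc))
  have ht : t ∈ Ioo t₁ t₂ := by
    refine ⟨hzK.1.1.lt_of_ne ?_, hzK.1.2.lt_of_ne ?_⟩
    · intro h
      have h1 := hb2 t x y htpos htlt
      have h2 : H (t, x, y) * t ^ (q - 1) ≤ κ * t ^ (q - 1) := by gcongr
      change t₁ = t at h
      rw [h] at ht₁'
      linarith
    · intro h
      have h1 := hb1 t x y htpos htlt
      change t = t₂ at h
      rw [← h] at ht₂'
      linarith
  set l := H (t, x, y) with hl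
  have hgl : convexityGap q t x y = l * ((1 - t) * t ^ q) := by
    rw [hl]
    simp only [H]
    rw [div_mul_cancel₀ _ (hw t htpos htlt).ne']
  -- Clearing the denominator: the gap minus `l (1 - t) t^q`, with `l` the minimal value, has a
  -- local minimum at the same point and is simpler to differentiate.
  have hF : ∀ t' ∈ Ioo t₁ t₂, ∀ x' ∈ Ioo (-1 : ℝ) 1, ∀ y' ∈ Ioo (-1 : ℝ) 1,
      convexityGap q t x y - l * ((1 - t) * t ^ q)
        ≤ convexityGap q t' x' y' - l * ((1 - t') * t' ^ q) := by
    intro t' ht' x' hx' y' hy'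
    have h1 : l ≤ H (t', x', y') := hmin (show (t', x', y') ∈ K from
      ⟨Ioo_subset_Icc_self ht', Ioo_subset_Icc_self hx', Ioo_subset_Icc_self hy'⟩)
    have := (le_div_iff₀ (hw t' (ht₁.1.trans ht'.1) (ht'.2.trans ht₂.2))).1 h1
    rw [hgl]
    linarith
  have hsq : ∀ u : ℝ, HasDerivAt (fun u : ℝ => u ^ 2) (2 * u) u := fun u => by
    simpa using hasDerivAt_pow 2 u
  have dx : HasDerivAt (fun x' => convexityGap q t x' y - l * ((1 - t) * t ^ q))
      ((1 - t) * (q * ((x + t) ^ 2 + y ^ 2) ^ (q - 1) * (2 * (x + t)))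
        + t * (q * ((x - 1 + t) ^ 2 + y ^ 2) ^ (q - 1) * (2 * (x - 1 + t)))
        - q * (x ^ 2 + y ^ 2) ^ (q - 1) * (2 * x)) x := by
    have e1 : HasDerivAt (fun x' : ℝ => (x' + t) ^ 2 + y ^ 2) (2 * (x + t)) x := by
      simpa using ((hasDerivAt_id x).add_const t).pow 2 |>.add_const (y ^ 2)
    have e2 : HasDerivAt (fun x' : ℝ => (x' - 1 + t) ^ 2 + y ^ 2) (2 * (x - 1 + t)) x := by
      simpa using (((hasDerivAt_id x).sub_const 1).add_const t).pow 2 |>.add_const (y ^ 2)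
    exact ((((hasDerivAt_rpow_comp hq.le e1).const_mul (1 - t)).add
      ((hasDerivAt_rpow_comp hq.le e2).const_mul t)).sub
      (hasDerivAt_rpow_comp hq.le ((hsq x).add_const (y ^ 2)))).sub_const _
  have dy : HasDerivAt (fun y' => convexityGap q t x y' - l * ((1 - t) * t ^ q))
      ((1 - t) * (q * ((x + t) ^ 2 + y ^ 2) ^ (q - 1) * (2 * y))
        + t * (q * ((x - 1 + t) ^ 2 + y ^ 2) ^ (q - 1) * (2 * y))
        - q * (x ^ 2 + y ^ 2) ^ (q - 1) * (2 * y)) y := by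
    exact ((((hasDerivAt_rpow_comp hq.le ((hsq y).const_add ((x + t) ^ 2))).const_mul (1 - t)).add
      ((hasDerivAt_rpow_comp hq.le ((hsq y).const_add ((x - 1 + t) ^ 2))).const_mul t)).sub
      (hasDerivAt_rpow_comp hq.le ((hsq y).const_add (x ^ 2)))).sub_const _
  have dt : HasDerivAt (fun t' => convexityGap q t' x y - l * ((1 - t') * t' ^ q))
      ((-1) * ((x + t) ^ 2 + y ^ 2) ^ q
        + (1 - t) * (q * ((x + t) ^ 2 + y ^ 2) ^ (q - 1) * (2 * (x + t)))
        + (1 * ((x - 1 + t) ^ 2 + y ^ 2) ^ q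
          + t * (q * ((x - 1 + t) ^ 2 + y ^ 2) ^ (q - 1) * (2 * (x - 1 + t))))
        - l * ((-1) * t ^ q + (1 - t) * (q * t ^ (q - 1)))) t := by
    have e1 : HasDerivAt (fun t' : ℝ => (x + t') ^ 2 + y ^ 2) (2 * (x + t)) t := by
      simpa using ((hasDerivAt_id t).const_add x).pow 2 |>.add_const (y ^ 2)
    have e2 : HasDerivAt (fun t' : ℝ => (x - 1 + t') ^ 2 + y ^ 2) (2 * (x - 1 + t)) t := by
      simpa using ((hasDerivAt_id t).const_add (x - 1)).pow 2 |>.add_const (y ^ 2)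
    have e0 := (hasDerivAt_id t).const_sub 1
    exact (((e0.mul (hasDerivAt_rpow_comp hq.le e1)).add
      ((hasDerivAt_id t).mul (hasDerivAt_rpow_comp hq.le e2))).sub_const _).sub
      ((e0.mul (Real.hasDerivAt_rpow_const (Or.inr hq.le))).const_mul l)
  have hx0 := (IsLocalMin.hasDerivAt_eq_zero (by
    filter_upwards [Ioo_mem_nhds hx.1 hx.2] with x' hx'
    using hF t ht x' hx' y hy) dx)
  have hy0 := (IsLocalMin.hasDerivAt_eq_zero (by
    filter_upwards [Ioo_mem_nhds hy.1 hy.2] with y' hy'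
    using hF t ht x hx y' hy') dy)
  have ht0' := (IsLocalMin.hasDerivAt_eq_zero (by
    filter_upwards [Ioo_mem_nhds ht.1 ht.2] with t' ht'
    using hF t' ht' x hx y hy) dt)
  have hqq : 2 * q ≠ 0 := by linarith
  refine false_of_critical hq htpos htlt (x := x) (y := y) rfl rfl rfl rfl
    (mul_left_cancel₀ hqq ?_) (mul_left_cancel₀ hqq ?_) ?_
  · linarith
  · linarith
  · change _ = convexityGap q t x y * _
    rw [hgl]
    rw [Real.rpow_sub_one htpos.ne'] at ht0'
    have h1 : t * (1 - t) * (l * ((-1) * t ^ q + (1 - t) * (q * (t ^ q / t))))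
        = l * ((1 - t) * t ^ q) * (q * (1 - t) - t) := by
      field_simp
      ring
    rw [← h1]
    linear_combination t * (1 - t) * ht0'

/-! ### The pointwise ground state inequality. -/

theorem norm_rpow_eq (p : ℝ) (z : ℂ) : ‖z‖ ^ p = (z.re ^ 2 + z.im ^ 2) ^ (p / 2) := by
  have e : z.re ^ 2 + z.im ^ 2 = ‖z‖ ^ 2 := by rw [Complex.sq_norm, Complex.normSq_apply]; ring
  rw [e, sq_rpow_eq_abs_rpow, abs_of_nonneg (norm_nonneg z)]
  ring_nf

theorem norm_sub_mul_sq {t : ℝ} (z w : ℂ) :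
    (1 - t) * (‖z‖ ^ 2 - t * ‖w‖ ^ 2) + t * ‖z - w‖ ^ 2 = ‖z - t * w‖ ^ 2 := by
  simp only [Complex.sq_norm, Complex.normSq_apply, Complex.sub_re, Complex.sub_im,
    Complex.mul_re, Complex.mul_im, Complex.ofReal_re, Complex.ofReal_im]
  ring

/-- The scaled complex form of the convexity inequality with the sharp remainder. -/
theorem norm_sub_mul_rpow_ge {p : ℝ} (hp : 2 ≤ p) {t : ℝ} (ht0 : 0 < t) (ht1 : t < 1) (z w : ℂ) :
    (1 - t) ^ (p - 1) * (‖z‖ ^ p - t * ‖w‖ ^ p) + remainderConst p * (t ^ (p / 2) * ‖z - w‖ ^ p)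
      ≤ ‖z - t * w‖ ^ p := by
  have h1t : 0 < 1 - t := by linarith
  have hpow : (1 - t) ^ p = (1 - t) * (1 - t) ^ (p - 1) := by
    rw [Real.rpow_sub_one h1t.ne']; field_simp
  rcases hp.eq_or_lt with rfl | hp2
  · rw [remainderConst_two]
    have := norm_sub_mul_sq (t := t) z w
    norm_num
    linarith
  rcases eq_or_ne z w with rfl | hzw
  · have e : z - t * z = ((1 - t : ℝ) : ℂ) * z := by push_cast; ring
    rw [e, norm_mul, Complex.norm_real, Real.norm_of_nonneg h1t.le,
      Real.mul_rpow h1t.le (norm_nonneg z), hpow, sub_self, norm_zero,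
      Real.zero_rpow (by linarith)]
    apply le_of_eq
    ring
  have hsub : z - w ≠ 0 := sub_ne_zero.2 hzw
  set D := ‖z - w‖ ^ p with hD
  have hD0 : 0 < D := Real.rpow_pos_of_pos (norm_pos_iff.2 hsub) _
  -- With this `m`, the points `m + t` and `m - 1 + t` are `z - t w` and `(1 - t) w` divided by `z -
  -- w`, so the gap inequality for `m`, multiplied by `|z - w|^p`, is `1 - t` times the claim.
  set m : ℂ := ((1 - t : ℝ) : ℂ) * z / (z - w) with hm
  have hA : m + (t : ℂ) = (z - t * w) / (z - w) := by
    rw [hm]; push_cast; field_simp; ring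
  have hB : m - 1 + (t : ℂ) = ((1 - t : ℝ) : ℂ) * w / (z - w) := by
    rw [hm]; push_cast; field_simp; ring
  have hgap := le_convexityGap (q := p / 2) (by linarith) ht0 ht1 m.re m.im
  have eA : ‖m + (t : ℂ)‖ ^ p = ((m.re + t) ^ 2 + m.im ^ 2) ^ (p / 2) := by
    rw [norm_rpow_eq]; simp
  have eB : ‖m - 1 + (t : ℂ)‖ ^ p = ((m.re - 1 + t) ^ 2 + m.im ^ 2) ^ (p / 2) := by
    rw [norm_rpow_eq]; simp
  unfold convexityGap at hgap
  rw [← eA, ← eB, ← norm_rpow_eq, hA, hB, hm, mul_div_cancel₀ p two_ne_zero] at hgap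
  simp only [norm_div, norm_mul, Complex.norm_real, Real.norm_of_nonneg h1t.le] at hgap
  rw [Real.div_rpow (norm_nonneg _) (norm_nonneg _), Real.div_rpow (by positivity) (norm_nonneg _),
    Real.div_rpow (by positivity) (norm_nonneg _), Real.mul_rpow h1t.le (norm_nonneg _),
    Real.mul_rpow h1t.le (norm_nonneg _), ← hD, hpow] at hgap
  have h2 : (1 - t) * ((1 - t) ^ (p - 1) * (‖z‖ ^ p - t * ‖w‖ ^ p)
      + remainderConst p * (t ^ (p / 2) * D)) ≤ (1 - t) * ‖z - t * w‖ ^ p := by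
    have h3 := mul_le_mul_of_nonneg_right hgap hD0.le
    have h4 : ((1 - t) * (‖z - t * w‖ ^ p / D)
        + t * ((1 - t) * (1 - t) ^ (p - 1) * ‖w‖ ^ p / D)
        - (1 - t) * (1 - t) ^ (p - 1) * ‖z‖ ^ p / D) * D
        = (1 - t) * ‖z - t * w‖ ^ p - (1 - t) * ((1 - t) ^ (p - 1) * (‖z‖ ^ p - t * ‖w‖ ^ p)) := by
      field_simp
      ring
    rw [h4] at h3
    linarith
  exact le_of_mul_le_mul_left h2 h1t

/-- The pointwise ground state inequality for two weights `b < a`. -/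
theorem norm_mul_sub_mul_rpow_ge {p : ℝ} (hp : 2 ≤ p) {a b : ℝ} (hb : 0 < b) (hab : b < a)
    (z w : ℂ) :
    (a - b) ^ (p - 1) * (a * ‖z‖ ^ p - b * ‖w‖ ^ p)
      + remainderConst p * ((a * b) ^ (p / 2) * ‖z - w‖ ^ p) ≤ ‖a * z - b * w‖ ^ p := by
  have ha : 0 < a := hb.trans hab
  have h := norm_sub_mul_rpow_ge hp (div_pos hb ha) ((div_lt_one ha).2 hab) z w
  have e0 : (a : ℂ) * z - b * w = (a : ℂ) * (z - ((b / a : ℝ) : ℂ) * w) := by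
    have : (a : ℂ) ≠ 0 := by exact_mod_cast ha.ne'
    push_cast
    field_simp
  have e1 : 1 - b / a = (a - b) / a := by field_simp
  have e2 : (a * b) ^ (p / 2) = a ^ p * (b / a) ^ (p / 2) := by
    rw [Real.div_rpow hb.le ha.le, Real.mul_rpow ha.le hb.le]
    have : a ^ p = a ^ (p / 2) * a ^ (p / 2) := by rw [← Real.rpow_add ha]; ring_nf
    rw [this]
    have : a ^ (p / 2) ≠ 0 := by positivity
    field_simp
  rw [e0, norm_mul, Complex.norm_real, Real.norm_of_nonneg ha.le,
    Real.mul_rpow ha.le (norm_nonneg _), e2]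
  have hap : 0 < a ^ p := by positivity
  refine le_trans (le_of_eq ?_) (mul_le_mul_of_nonneg_left h hap.le)
  rw [e1, Real.div_rpow (sub_pos.2 hab).le ha.le (p - 1), Real.rpow_sub_one ha.ne']
  field_simp

theorem norm_mul_sub_mul_sq {a b : ℝ} (z w : ℂ) :
    (a - b) * (a * ‖z‖ ^ 2 - b * ‖w‖ ^ 2) + a * b * ‖z - w‖ ^ 2 = ‖a * z - b * w‖ ^ 2 := by
  simp only [Complex.sq_norm, Complex.normSq_apply, Complex.sub_re, Complex.sub_im,
    Complex.mul_re, Complex.mul_im, Complex.ofReal_re, Complex.ofReal_im]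
  ring

/-! ### Polar coordinates for functions of `|y|` and one coordinate. -/

/-- Integration of a radial function in polar coordinates. -/
theorem lintegral_radial {d : ℕ} (hd : 1 ≤ d) {f : ℝ → ℝ≥0∞} (hf : Measurable f) :
    ∫⁻ z : EuclideanSpace ℝ (Fin d), f ‖z‖
      = sphereArea d * ∫⁻ r in Ioi (0 : ℝ), ENNReal.ofReal (r ^ (d - 1)) * f r := by
  have : Nonempty (Fin d) := ⟨⟨0, hd⟩⟩
  have hdim : Module.finrank ℝ (EuclideanSpace ℝ (Fin d)) = d := by simp
  set μ : Measure (EuclideanSpace ℝ (Fin d)) := volume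
  calc
    ∫⁻ x, f ‖x‖ ∂μ = ∫⁻ x : ({(0)}ᶜ : Set (EuclideanSpace ℝ (Fin d))), f ‖x.1‖ ∂(μ.comap (↑)) := by
      rw [lintegral_subtype_comap (measurableSet_singleton _).compl fun x ↦ f (‖x‖),
        restrict_compl_singleton]
    _ = ∫⁻ x, f x.2 ∂μ.toSphere.prod (.volumeIoiPow (d - 1)) := by
      have h := μ.measurePreserving_homeomorphUnitSphereProd
      rw [hdim] at h
      simpa using h.lintegral_comp_emb (Homeomorph.measurableEmbedding _)
        (f ∘ Subtype.val ∘ Prod.snd)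
    _ = μ.toSphere univ * ∫⁻ x : Ioi (0 : ℝ), f x ∂.volumeIoiPow (d - 1) := by
      rw [lintegral_prod _ (by fun_prop)]
      simp [mul_comm]
    _ = _ := by
      rw [Measure.volumeIoiPow, lintegral_withDensity_eq_lintegral_mul _ (by fun_prop)
        (by fun_prop)]
      congr 1
      exact lintegral_subtype_comap measurableSet_Ioi
        fun r : ℝ => ENNReal.ofReal (r ^ (d - 1)) * f r

theorem lintegral_euclidean_succ {d : ℕ} {F : ℝ × ℝ → ℝ≥0∞} (hF : Measurable F) :
    ∫⁻ y : EuclideanSpace ℝ (Fin (d + 1)), F (‖y‖, y 0)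
      = ∫⁻ τ : ℝ, ∫⁻ z : EuclideanSpace ℝ (Fin d), F (√(τ ^ 2 + ‖z‖ ^ 2), τ) := by
  have hG : Measurable fun y : EuclideanSpace ℝ (Fin (d + 1)) => F (‖y‖, y 0) := by fun_prop
  have h1 := (PiLp.volume_preserving_toLp (Fin (d + 1))).lintegral_comp hG
  have h2 := ((volume_preserving_piFinSuccAbove (fun _ : Fin (d + 1) => ℝ) 0).symm).lintegral_comp
    (hG.comp (PiLp.volume_preserving_toLp (Fin (d + 1))).measurable)
  rw [← h1]
  simp only [Function.comp_def] at h2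
  rw [← h2, Measure.volume_eq_prod, lintegral_prod]
  · congr with τ
    have hg : Measurable fun z : EuclideanSpace ℝ (Fin d) => F (√(τ ^ 2 + ‖z‖ ^ 2), τ) := by
      fun_prop
    rw [← (PiLp.volume_preserving_toLp (Fin d)).lintegral_comp hg]
    congr with z
    congr 2
    rw [EuclideanSpace.norm_eq, EuclideanSpace.norm_eq, Real.sq_sqrt (by positivity)]
    congr 1
    rw [Fin.sum_univ_succ]
    simp [MeasurableEquiv.piFinSuccAbove]
  · apply Measurable.aemeasurable
    exact (hG.comp (PiLp.volume_preserving_toLp (Fin (d + 1))).measurable).comp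
      (MeasurableEquiv.measurable _)

theorem lintegral_cos_Ioo {g : ℝ → ℝ≥0∞} :
    ∫⁻ t in Ioo (-1 : ℝ) 1, g t
      = ∫⁻ θ in Ioo 0 Real.pi, ENNReal.ofReal (Real.sin θ) * g (Real.cos θ) := by
  have himg : Real.cos '' Ioo 0 Real.pi = Ioo (-1) 1 := by
    ext t
    constructor
    · rintro ⟨θ, hθ, rfl⟩
      constructor
      · rw [← Real.cos_pi]
        exact Real.cos_lt_cos_of_nonneg_of_le_pi hθ.1.le le_rfl hθ.2
      · rw [← Real.cos_zero]
        exact Real.cos_lt_cos_of_nonneg_of_le_pi le_rfl hθ.2.le hθ.1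
    · rintro ht
      refine ⟨Real.arccos t, ⟨Real.arccos_pos.2 ht.2, ?_⟩, Real.cos_arccos ht.1.le ht.2.le⟩
      refine lt_of_le_of_ne (Real.arccos_le_pi t) fun h => ?_
      rw [Real.arccos_eq_pi] at h
      linarith [ht.1]
  rw [← himg, lintegral_image_eq_lintegral_abs_deriv_mul measurableSet_Ioo
    (fun θ _ => (Real.hasDerivAt_cos θ).hasDerivWithinAt)
    (Real.injOn_cos.mono Ioo_subset_Icc_self)]
  refine setLIntegral_congr_fun measurableSet_Ioo fun θ hθ => ?_
  rw [abs_neg, abs_of_pos (Real.sin_pos_of_mem_Ioo hθ)]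

theorem sin_pow_eq {d : ℕ} (hd : 1 ≤ d) {θ : ℝ} (hθ : θ ∈ Ioo 0 Real.pi) :
    Real.sin θ ^ (d - 1) = Real.sin θ * (1 - Real.cos θ ^ 2) ^ (((d : ℝ) - 2) / 2) := by
  have hs := Real.sin_pos_of_mem_Ioo hθ
  rw [← Real.sin_sq, ← Real.rpow_natCast _ 2, ← Real.rpow_mul hs.le, mul_comm,
    ← Real.rpow_add_one hs.ne', ← Real.rpow_natCast, Nat.cast_sub hd]
  congr 1
  push_cast
  ring

/-- Planar polar coordinates `τ = r cos θ`, `ρ = r sin θ` on the half-plane `ρ > 0`, followed by `t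
= cos θ`. The Jacobian `r` and `ρ^(d-1)` combine to `r^d sin^(d-1) θ`, which produces the weight in
`t`. -/
theorem lintegral_halfPlane {d : ℕ} (hd : 1 ≤ d) {F : ℝ × ℝ → ℝ≥0∞} (hF : Measurable F) :
    ∫⁻ τ : ℝ, ∫⁻ ρ in Ioi (0 : ℝ), ENNReal.ofReal (ρ ^ (d - 1)) * F (√(τ ^ 2 + ρ ^ 2), τ)
      = ∫⁻ r in Ioi (0 : ℝ), ENNReal.ofReal (r ^ d) * ∫⁻ t in Ioo (-1 : ℝ) 1,
          ENNReal.ofReal ((1 - t ^ 2) ^ (((d : ℝ) - 2) / 2)) * F (r, r * t) := by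
  let f : ℝ × ℝ → ℝ≥0∞ := (univ ×ˢ Ioi (0 : ℝ)).indicator
    fun z => ENNReal.ofReal (z.2 ^ (d - 1)) * F (√(z.1 ^ 2 + z.2 ^ 2), z.1)
  have hf : Measurable f :=
    Measurable.indicator (by fun_prop) (MeasurableSet.univ.prod measurableSet_Ioi)
  have hleft : ∫⁻ z, f z = ∫⁻ τ : ℝ, ∫⁻ ρ in Ioi (0 : ℝ),
      ENNReal.ofReal (ρ ^ (d - 1)) * F (√(τ ^ 2 + ρ ^ 2), τ) := by
    rw [Measure.volume_eq_prod, lintegral_prod _ hf.aemeasurable]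
    congr with τ
    rw [← lintegral_indicator measurableSet_Ioi]
    congr with ρ
    by_cases h : 0 < ρ <;> simp [f, h]
  rw [← hleft, ← lintegral_comp_polarCoord_symm, polarCoord_target]
  have hm : Measurable fun z : ℝ × ℝ => ENNReal.ofReal z.1 • f (polarCoord.symm z) :=
    (ENNReal.measurable_ofReal.comp measurable_fst).smul
      (hf.comp continuous_polarCoord_symm.measurable)
  rw [Measure.volume_eq_prod, ← Measure.prod_restrict, lintegral_prod _ hm.aemeasurable]
  refine setLIntegral_congr_fun measurableSet_Ioi fun r hr => ?_
  have hr : 0 < r := hr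
  simp only
  rw [lintegral_cos_Ioo, ← lintegral_const_mul' _ _ ENNReal.ofReal_ne_top]
  have hsub : Ioo 0 Real.pi ⊆ Ioo (-Real.pi) Real.pi :=
    Ioo_subset_Ioo_left (by linarith [Real.pi_pos])
  rw [← lintegral_indicator measurableSet_Ioo, ← lintegral_indicator measurableSet_Ioo]
  congr with θ
  by_cases hθ : θ ∈ Ioo 0 Real.pi
  · have hs := Real.sin_pos_of_mem_Ioo hθ
    rw [indicator_of_mem (hsub hθ), indicator_of_mem hθ]
    have hmem : polarCoord.symm (r, θ) ∈ (univ : Set ℝ) ×ˢ Ioi (0 : ℝ) := by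
      simp [polarCoord, hr, hs]
    simp only [f]
    rw [indicator_of_mem hmem]
    have e1 : √((r * Real.cos θ) ^ 2 + (r * Real.sin θ) ^ 2) = r := by
      rw [show (r * Real.cos θ) ^ 2 + (r * Real.sin θ) ^ 2 = r ^ 2 by
        have := Real.sin_sq_add_cos_sq θ
        linear_combination r ^ 2 * this, Real.sqrt_sq hr.le]
    have e2 : polarCoord.symm (r, θ) = (r * Real.cos θ, r * Real.sin θ) := rfl
    simp only [e2, e1, smul_eq_mul, ← mul_assoc]
    congr 1
    rw [← ENNReal.ofReal_mul hr.le, ← ENNReal.ofReal_mul (by positivity),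
      ← ENNReal.ofReal_mul (by positivity), mul_pow, sin_pow_eq hd hθ]
    congr 1
    have : r ^ d = r * r ^ (d - 1) := by
      rw [← pow_succ']
      congr 1
      omega
    rw [this]
    ring
  · rw [indicator_of_notMem hθ]
    by_cases h2 : θ ∈ Ioo (-Real.pi) Real.pi
    · rw [indicator_of_mem h2]
      have hs : Real.sin θ ≤ 0 := by
        apply Real.sin_nonpos_of_nonpos_of_neg_pi_le _ h2.1.le
        by_contra! h
        exact hθ ⟨h, h2.2⟩
      have hmem : polarCoord.symm (r, θ) ∉ (univ : Set ℝ) ×ˢ Ioi (0 : ℝ) := by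
        intro h
        have h3 : 0 < r * Real.sin θ := h.2
        have := pos_of_mul_pos_right h3 hr.le
        linarith
      simp only [f]
      rw [indicator_of_notMem hmem]
      simp
    · rw [indicator_of_notMem h2]

/-- The integral over the unit sphere of a function of one coordinate. -/
noncomputable def sphereIntegral (N : ℕ) (h : ℝ → ℝ≥0∞) : ℝ≥0∞ :=
  if N = 1 then h 1 + h (-1)
  else sphereArea (N - 1) * ∫⁻ t in Ioo (-1 : ℝ) 1,
    ENNReal.ofReal ((1 - t ^ 2) ^ (((N : ℝ) - 3) / 2)) * h t

/-- Polar coordinates for functions of the norm and of one coordinate. -/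
theorem lintegral_norm_coord {d : ℕ} {F : ℝ × ℝ → ℝ≥0∞} (hF : Measurable F) :
    ∫⁻ y : EuclideanSpace ℝ (Fin (d + 1)), F (‖y‖, y 0)
      = ∫⁻ r in Ioi (0 : ℝ), ENNReal.ofReal (r ^ d) *
          sphereIntegral (d + 1) (fun t => F (r, r * t)) := by
  rw [lintegral_euclidean_succ hF]
  rcases Nat.eq_zero_or_pos d with rfl | hd
  · have h1 : ∀ τ : ℝ, ∫⁻ z : EuclideanSpace ℝ (Fin 0), F (√(τ ^ 2 + ‖z‖ ^ 2), τ) = F (|τ|, τ) := by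
      intro τ
      rw [volume_euclideanSpace_eq_dirac, lintegral_dirac]
      simp [Real.sqrt_sq_eq_abs]
    simp only [h1]
    have hm : Measurable fun τ : ℝ => F (|τ|, τ) := by fun_prop
    rw [← lintegral_add_compl _ (measurableSet_Ioi (a := (0 : ℝ))), compl_Ioi,
      ← setLIntegral_congr Iio_ae_eq_Iic]
    have h2 : ∫⁻ τ in Iio (0 : ℝ), F (|τ|, τ) = ∫⁻ τ in Ioi (0 : ℝ), F (|τ|, -τ) := by
      have := (Measure.measurePreserving_neg (volume : Measure ℝ)).setLIntegral_comp_preimage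
        (measurableSet_Iio (a := (0 : ℝ))) hm
      rw [← this]
      simp
    rw [h2, ← lintegral_add_left hm]
    refine setLIntegral_congr_fun measurableSet_Ioi fun r hr => ?_
    have hr : 0 < r := hr
    simp [sphereIntegral, abs_of_pos hr]
  · have h1 : ∀ τ : ℝ, ∫⁻ z : EuclideanSpace ℝ (Fin d), F (√(τ ^ 2 + ‖z‖ ^ 2), τ)
        = sphereArea d * ∫⁻ ρ in Ioi (0 : ℝ), ENNReal.ofReal (ρ ^ (d - 1)) *
          F (√(τ ^ 2 + ρ ^ 2), τ) := fun τ =>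
      lintegral_radial hd (f := fun ρ => F (√(τ ^ 2 + ρ ^ 2), τ)) (by fun_prop)
    have hA : sphereArea d ≠ ⊤ := measure_ne_top _ _
    simp only [h1]
    rw [lintegral_const_mul' _ _ hA, lintegral_halfPlane hd hF, ← lintegral_const_mul' _ _ hA]
    congr with r
    have e : ((d + 1 : ℕ) : ℝ) - 3 = (d : ℝ) - 2 := by push_cast; ring
    rw [sphereIntegral, if_neg (by omega), e, Nat.add_sub_cancel]
    ring

theorem sphereIntegral_congr (N : ℕ) {h g : ℝ → ℝ≥0∞} (hg : ∀ t ∈ Icc (-1 : ℝ) 1, h t = g t) :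
    sphereIntegral N h = sphereIntegral N g := by
  unfold sphereIntegral
  rw [hg 1 (by norm_num), hg (-1) (by norm_num)]
  congr 2
  exact setLIntegral_congr_fun measurableSet_Ioo
    fun t ht => by simp only [hg t (Ioo_subset_Icc_self ht)]

theorem sphereIntegral_const_mul (N : ℕ) {h : ℝ → ℝ≥0∞} (hh : Measurable h) (c : ℝ≥0∞) :
    sphereIntegral N (fun t => c * h t) = c * sphereIntegral N h := by
  unfold sphereIntegral
  split_ifs
  · rw [mul_add]
  · rw [mul_left_comm c, ← lintegral_const_mul c (by fun_prop)]
    simp only [mul_left_comm c]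

/-! ### Integrals of radial functions against `|x - y|^(-N-ps)`. -/

/-- A reflection moves `x` to the first axis. Afterwards `|x - y|` depends only on `|y|` and the
first coordinate of `y`. -/
theorem exists_linearIsometryEquiv_eq {d : ℕ} (x : EuclideanSpace ℝ (Fin (d + 1))) :
    ∃ L : EuclideanSpace ℝ (Fin (d + 1)) ≃ₗᵢ[ℝ] EuclideanSpace ℝ (Fin (d + 1)),
      L x = EuclideanSpace.single 0 ‖x‖ :=
  ⟨_, Submodule.reflection_sub (by simp)⟩

theorem norm_single_sub_rpow {d : ℕ} {R : ℝ} (κ : ℝ)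
    (y : EuclideanSpace ℝ (Fin (d + 1))) :
    ‖EuclideanSpace.single 0 R - y‖ ^ κ = (R ^ 2 - 2 * R * y 0 + ‖y‖ ^ 2) ^ (κ / 2) := by
  have h : R ^ 2 - 2 * R * y 0 + ‖y‖ ^ 2 = ‖EuclideanSpace.single 0 R - y‖ ^ 2 := by
    rw [norm_sub_sq_real, EuclideanSpace.inner_single_left]
    simp
    ring
  rw [h, ← Real.rpow_natCast, ← Real.rpow_mul (norm_nonneg _)]
  congr 1
  push_cast
  ring

/-- The integral of a radial function against a power of the distance to a point. -/
theorem lintegral_radial_mul_kernel {N : ℕ} (hN : 1 ≤ N) {f : ℝ → ℝ≥0∞} (hf : Measurable f)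
    (κ : ℝ) (x : EuclideanSpace ℝ (Fin N)) :
    ∫⁻ y, f ‖y‖ * ENNReal.ofReal (1 / ‖x - y‖ ^ κ)
      = ∫⁻ r in Ioi (0 : ℝ), ENNReal.ofReal (r ^ ((N : ℝ) - 1)) * (f r * sphereIntegral N
          (fun t => ENNReal.ofReal (1 / (‖x‖ ^ 2 - 2 * ‖x‖ * (r * t) + r ^ 2) ^ (κ / 2)))) := by
  obtain ⟨d, rfl⟩ : ∃ d, N = d + 1 := ⟨N - 1, by omega⟩
  obtain ⟨L, hL⟩ := exists_linearIsometryEquiv_eq x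
  let F : ℝ × ℝ → ℝ≥0∞ := fun z =>
    f z.1 * ENNReal.ofReal (1 / (‖x‖ ^ 2 - 2 * ‖x‖ * z.2 + z.1 ^ 2) ^ (κ / 2))
  have hF : Measurable F := by fun_prop
  have h1 : ∀ y, f ‖y‖ * ENNReal.ofReal (1 / ‖x - y‖ ^ κ) = F (‖L y‖, L y 0) := by
    intro y
    simp only [F]
    rw [← norm_single_sub_rpow, ← hL, ← map_sub, L.norm_map, L.norm_map]
  have hFm : Measurable fun y : EuclideanSpace ℝ (Fin (d + 1)) => F (‖y‖, y 0) := by fun_prop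
  simp only [h1]
  rw [L.measurePreserving.lintegral_comp hFm, lintegral_norm_coord hF]
  congr with r
  have e : (r : ℝ) ^ ((d + 1 : ℕ) - 1 : ℝ) = r ^ d := by
    rw [← Real.rpow_natCast]
    congr 1
    push_cast
    ring
  rw [e]
  have h := sphereIntegral_const_mul (d + 1) (h := fun t => ENNReal.ofReal
    (1 / (‖x‖ ^ 2 - 2 * ‖x‖ * (r * t) + r ^ 2) ^ (κ / 2))) (by fun_prop) (f r)
  exact congrArg _ h

theorem quadratic_nonneg {R r t : ℝ} (hR : 0 ≤ R) (hr : 0 ≤ r) (ht : t ∈ Icc (-1 : ℝ) 1) :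
    0 ≤ R ^ 2 - 2 * R * (r * t) + r ^ 2 := by
  have : 0 ≤ R * r * (1 - t) := mul_nonneg (mul_nonneg hR hr) (by linarith [ht.2])
  nlinarith [sq_nonneg (R - r)]

theorem angularKernel_eq {N : ℕ} (s p : ℝ) {r : ℝ} (h1 : r < 1) (h0 : 0 < r) :
    angularKernel N s p r = sphereIntegral N
      (fun t => ENNReal.ofReal (1 / (1 - 2 * (r * t) + r ^ 2) ^ (((N : ℝ) + p * s) / 2))) := by
  unfold angularKernel sphereIntegral
  split_ifs with hN
  · subst hN
    have e : ∀ a : ℝ, 0 ≤ a → (a ^ 2) ^ ((((1 : ℕ) : ℝ) + p * s) / 2) = a ^ (1 + p * s) := by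
      intro a ha
      rw [← Real.rpow_natCast, ← Real.rpow_mul ha]
      congr 1
      push_cast
      ring
    beta_reduce
    rw [show 1 - 2 * (r * 1) + r ^ 2 = (1 - r) ^ 2 by ring,
      show 1 - 2 * (r * -1) + r ^ 2 = (1 + r) ^ 2 by ring, e _ (by linarith), e _ (by linarith),
      ENNReal.ofReal_add]
    · exact div_nonneg zero_le_one (Real.rpow_nonneg (by linarith) _)
    · exact div_nonneg zero_le_one (Real.rpow_nonneg (by linarith) _)
  · congr 1
    refine setLIntegral_congr_fun measurableSet_Ioo fun t ht => ?_
    have : 0 ≤ 1 - t ^ 2 := by nlinarith [ht.1, ht.2]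
    simp only
    rw [← ENNReal.ofReal_mul (Real.rpow_nonneg this _), mul_one_div, mul_assoc]

/-- Homogeneity: the quadratic form is `R²` times its value at radii `1` and `r/R`, so only the
ratio of the smaller to the larger radius enters `angularKernel`. -/
theorem sphereIntegral_kernel_eq {N : ℕ} (s p : ℝ) {R r : ℝ} (h0 : 0 < r) (h1 : r < R) :
    sphereIntegral N (fun t => ENNReal.ofReal
        (1 / (R ^ 2 - 2 * R * (r * t) + r ^ 2) ^ (((N : ℝ) + p * s) / 2)))
      = ENNReal.ofReal (R ^ (-((N : ℝ) + p * s))) * angularKernel N s p (r / R) := by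
  have hR : 0 < R := h0.trans h1
  rw [angularKernel_eq s p ((div_lt_one hR).2 h1) (div_pos h0 hR),
    ← sphereIntegral_const_mul _ (by fun_prop)]
  refine sphereIntegral_congr N fun t ht => ?_
  have hq := quadratic_nonneg (R := 1) (r := r / R) zero_le_one (by positivity) ht
  have e : R ^ 2 - 2 * R * (r * t) + r ^ 2
      = R ^ 2 * (1 ^ 2 - 2 * 1 * (r / R * t) + (r / R) ^ 2) := by
    field_simp
  have e2 : (R ^ 2) ^ (((N : ℝ) + p * s) / 2) = R ^ ((N : ℝ) + p * s) := by
    rw [← Real.rpow_natCast, ← Real.rpow_mul hR.le]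
    congr 1
    push_cast
    ring
  rw [e, Real.mul_rpow (by positivity) hq, e2, ← ENNReal.ofReal_mul (by positivity),
    Real.rpow_neg hR.le]
  congr 1
  simp only [one_pow, mul_one]
  rw [one_div, one_div, mul_inv]

/-- The integral of a radial function over a small ball against the kernel. -/
theorem setLIntegral_kernel_inner {N : ℕ} (hN : 1 ≤ N) (s p : ℝ) {f : ℝ → ℝ≥0∞} (hf : Measurable f)
    {ρ : ℝ} (hρ1 : ρ ≤ 1) {x : EuclideanSpace ℝ (Fin N)} (hx : x ≠ 0) :
    ∫⁻ y in {y | ‖y‖ < ρ * ‖x‖}, f ‖y‖ * ENNReal.ofReal (1 / ‖x - y‖ ^ ((N : ℝ) + p * s))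
      = ENNReal.ofReal (‖x‖ ^ (-(p * s))) * ∫⁻ σ in Ioo 0 ρ, ENNReal.ofReal (σ ^ ((N : ℝ) - 1))
          * (f (‖x‖ * σ) * angularKernel N s p σ) := by
  have hR : 0 < ‖x‖ := norm_pos_iff.2 hx
  set R := ‖x‖
  have hS : MeasurableSet {y : EuclideanSpace ℝ (Fin N) | ‖y‖ < ρ * R} :=
    measurableSet_lt measurable_norm measurable_const
  rw [← lintegral_indicator hS]
  have e1 : ∀ y : EuclideanSpace ℝ (Fin N), {y | ‖y‖ < ρ * R}.indicator
      (fun y => f ‖y‖ * ENNReal.ofReal (1 / ‖x - y‖ ^ ((N : ℝ) + p * s))) y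
      = (Iio (ρ * R)).indicator f ‖y‖ * ENNReal.ofReal (1 / ‖x - y‖ ^ ((N : ℝ) + p * s)) := by
    intro y
    by_cases h : ‖y‖ < ρ * R <;> simp [h]
  simp only [e1]
  rw [lintegral_radial_mul_kernel hN (hf.indicator measurableSet_Iio)]
  have e2 : ∫⁻ r in Ioi (0 : ℝ), ENNReal.ofReal (r ^ ((N : ℝ) - 1)) *
      ((Iio (ρ * R)).indicator f r * sphereIntegral N (fun t => ENNReal.ofReal
        (1 / (R ^ 2 - 2 * R * (r * t) + r ^ 2) ^ (((N : ℝ) + p * s) / 2))))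
      = ∫⁻ r in (fun σ => R * σ) '' Ioo 0 ρ, ENNReal.ofReal (r ^ ((N : ℝ) - 1)) *
        (f r * (ENNReal.ofReal (R ^ (-((N : ℝ) + p * s))) * angularKernel N s p (r / R))) := by
    have himg : (fun σ => R * σ) '' Ioo 0 ρ = Ioo 0 (ρ * R) := by
      rw [image_mul_left_Ioo hR]
      simp [mul_comm]
    rw [himg, ← lintegral_indicator measurableSet_Ioi, ← lintegral_indicator measurableSet_Ioo]
    congr with r
    by_cases h0 : 0 < r
    · by_cases h1 : r < ρ * R
      · rw [indicator_of_mem (show r ∈ Ioi 0 from h0), indicator_of_mem (show r ∈ Ioo _ _ from ⟨h0, h1⟩),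
          indicator_of_mem (show r ∈ Iio _ from h1), sphereIntegral_kernel_eq s p h0]
        nlinarith
      · simp [h0, h1]
    · simp [h0]
  rw [e2, lintegral_image_eq_lintegral_abs_deriv_mul (f' := fun _ => R) measurableSet_Ioo
    (fun σ _ => by simpa using ((hasDerivAt_id σ).const_mul R).hasDerivWithinAt)
    (fun a _ b _ h => mul_left_cancel₀ hR.ne' h),
    ← lintegral_const_mul' _ _ ENNReal.ofReal_ne_top]
  refine setLIntegral_congr_fun measurableSet_Ioo fun σ hσ => ?_
  have e3 : ENNReal.ofReal (R ^ (-(p * s))) * ENNReal.ofReal (σ ^ ((N : ℝ) - 1))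
      = ENNReal.ofReal |R| * ENNReal.ofReal ((R * σ) ^ ((N : ℝ) - 1))
        * ENNReal.ofReal (R ^ (-((N : ℝ) + p * s))) := by
    have hσ0 := hσ.1
    rw [abs_of_pos hR, ← ENNReal.ofReal_mul (by positivity), ← ENNReal.ofReal_mul (by positivity),
      ← ENNReal.ofReal_mul (by positivity), Real.mul_rpow hR.le hσ0.le]
    congr 1
    have : R ^ (-(p * s)) = R * R ^ ((N : ℝ) - 1) * R ^ (-((N : ℝ) + p * s)) := by
      rw [mul_comm R, ← Real.rpow_add_one hR.ne', ← Real.rpow_add hR]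
      congr 1
      ring
    rw [this]
    ring
  rw [← mul_assoc (ENNReal.ofReal (R ^ (-(p * s)))), e3, mul_div_cancel_left₀ _ hR.ne']
  ring

/-- The integral of a radial function outside a large ball against the kernel. -/
theorem setLIntegral_kernel_outer {N : ℕ} (hN : 1 ≤ N) (s p : ℝ) {f : ℝ → ℝ≥0∞} (hf : Measurable f)
    {ρ : ℝ} (hρ : 0 < ρ) (hρ1 : ρ ≤ 1) {x : EuclideanSpace ℝ (Fin N)} (hx : x ≠ 0) :
    ∫⁻ y in {y | ‖x‖ < ρ * ‖y‖}, f ‖y‖ * ENNReal.ofReal (1 / ‖x - y‖ ^ ((N : ℝ) + p * s))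
      = ENNReal.ofReal (‖x‖ ^ (-(p * s))) * ∫⁻ σ in Ioo 0 ρ, ENNReal.ofReal (σ ^ (p * s - 1))
          * (f (‖x‖ / σ) * angularKernel N s p σ) := by
  have hR : 0 < ‖x‖ := norm_pos_iff.2 hx
  set R := ‖x‖
  have hS : MeasurableSet {y : EuclideanSpace ℝ (Fin N) | R < ρ * ‖y‖} :=
    measurableSet_lt measurable_const (by fun_prop)
  rw [← lintegral_indicator hS]
  have hiff : ∀ r : ℝ, R < ρ * r ↔ R / ρ < r := fun r => by rw [div_lt_iff₀' hρ]
  have e1 : ∀ y : EuclideanSpace ℝ (Fin N), {y | R < ρ * ‖y‖}.indicator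
      (fun y => f ‖y‖ * ENNReal.ofReal (1 / ‖x - y‖ ^ ((N : ℝ) + p * s))) y
      = (Ioi (R / ρ)).indicator f ‖y‖ * ENNReal.ofReal (1 / ‖x - y‖ ^ ((N : ℝ) + p * s)) := by
    intro y
    by_cases h : R / ρ < ‖y‖
    · have := (hiff ‖y‖).2 h
      simp [h, this]
    · have := mt (hiff ‖y‖).1 h
      simp [h, this]
  simp only [e1]
  rw [lintegral_radial_mul_kernel hN (hf.indicator measurableSet_Ioi)]
  have e2 : ∫⁻ r in Ioi (0 : ℝ), ENNReal.ofReal (r ^ ((N : ℝ) - 1)) *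
      ((Ioi (R / ρ)).indicator f r * sphereIntegral N (fun t => ENNReal.ofReal
        (1 / (R ^ 2 - 2 * R * (r * t) + r ^ 2) ^ (((N : ℝ) + p * s) / 2))))
      = ∫⁻ r in (fun σ => R / σ) '' Ioo 0 ρ, ENNReal.ofReal (r ^ ((N : ℝ) - 1)) *
        (f r * (ENNReal.ofReal (r ^ (-((N : ℝ) + p * s))) * angularKernel N s p (R / r))) := by
    have himg : (fun σ => R / σ) '' Ioo 0 ρ = Ioi (R / ρ) := by
      ext r
      constructor
      · rintro ⟨σ, hσ, rfl⟩
        exact div_lt_div_of_pos_left hR hσ.1 hσ.2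
      · intro hr
        have hr0 : 0 < r := (div_pos hR hρ).trans hr
        refine ⟨R / r, ⟨div_pos hR hr0, ?_⟩, by field_simp⟩
        rw [div_lt_iff₀ hr0]
        exact (hiff r).2 hr
    rw [himg, ← lintegral_indicator measurableSet_Ioi, ← lintegral_indicator measurableSet_Ioi]
    congr with r
    by_cases h1 : R / ρ < r
    · have h0 : 0 < r := (div_pos hR hρ).trans h1
      have hRr : R < r := lt_of_le_of_lt (by rw [le_div_iff₀ hρ]; nlinarith) h1
      rw [indicator_of_mem (show r ∈ Ioi 0 from h0), indicator_of_mem (show r ∈ Ioi _ from h1),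
        -- Here `r > R`, so the form, symmetric in the two radii, is scaled by `r`. The substitution
        -- `r = R/σ` then makes `σ` the argument of the kernel.
        indicator_of_mem (show r ∈ Ioi _ from h1), ← sphereIntegral_kernel_eq s p hR hRr]
      congr 3 with t
      congr 3
      ring
    · by_cases h0 : 0 < r <;> simp [h0, h1]
  have hd : ∀ σ ∈ Ioo 0 ρ, HasDerivWithinAt (fun σ => R / σ) (-R / σ ^ 2) (Ioo 0 ρ) σ := by
    intro σ hσ
    have := ((hasDerivAt_inv hσ.1.ne').const_mul R).hasDerivWithinAt (s := Ioo 0 ρ)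
    simp only [← div_eq_mul_inv] at this
    convert! this using 1
    field_simp
  rw [e2, lintegral_image_eq_lintegral_abs_deriv_mul measurableSet_Ioo hd
    (fun a ha b hb h => by
      have := ha.1.ne'
      have := hb.1.ne'
      field_simp at h
      exact h.symm),
    ← lintegral_const_mul' _ _ ENNReal.ofReal_ne_top]
  refine setLIntegral_congr_fun measurableSet_Ioo fun σ hσ => ?_
  have hσ0 := hσ.1
  have e3 : ENNReal.ofReal (R ^ (-(p * s))) * ENNReal.ofReal (σ ^ (p * s - 1))
      = ENNReal.ofReal |-R / σ ^ 2| * ENNReal.ofReal ((R / σ) ^ ((N : ℝ) - 1))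
        * ENNReal.ofReal ((R / σ) ^ (-((N : ℝ) + p * s))) := by
    rw [neg_div, abs_neg, abs_of_pos (by positivity), ← ENNReal.ofReal_mul (by positivity),
      ← ENNReal.ofReal_mul (by positivity), ← ENNReal.ofReal_mul (by positivity), mul_assoc,
      ← Real.rpow_add (by positivity)]
    congr 1
    have : (N : ℝ) - 1 + -((N : ℝ) + p * s) = -(p * s) - 1 := by ring
    have e5 : σ ^ (-(p * s) - 1) = (σ ^ (p * s))⁻¹ / σ := by
      rw [Real.rpow_sub_one hσ0.ne', Real.rpow_neg hσ0.le]
    rw [this, Real.div_rpow hR.le hσ0.le, e5, Real.rpow_sub_one hR.ne', Real.rpow_sub_one hσ0.ne']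
    field_simp
  have e4 : R / (R / σ) = σ := by field_simp
  rw [← mul_assoc (ENNReal.ofReal (R ^ (-(p * s)))), e3, e4]
  ring

/-! ### Fubini on sections and the sectors `|y| < ρ|x|`. -/

theorem setLIntegral_prod_section {α β : Type*} [MeasurableSpace α] [MeasurableSpace β]
    {μ : Measure α} {ν : Measure β} [SFinite μ] [SFinite ν] {S : Set (α × β)}
    (hS : MeasurableSet S) {g : α × β → ℝ≥0∞} (hg : Measurable g) :
    ∫⁻ z in S, g z ∂(μ.prod ν) = ∫⁻ x, ∫⁻ y in {y | (x, y) ∈ S}, g (x, y) ∂ν ∂μ := by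
  rw [← lintegral_indicator hS, lintegral_prod _ (hg.indicator hS).aemeasurable]
  congr with x
  have h : MeasurableSet {y | (x, y) ∈ S} := measurable_prodMk_left hS
  rw [← lintegral_indicator h]
  rfl

theorem setLIntegral_prod_section_symm {α β : Type*} [MeasurableSpace α] [MeasurableSpace β]
    {μ : Measure α} {ν : Measure β} [SFinite μ] [SFinite ν] {S : Set (α × β)}
    (hS : MeasurableSet S) {g : α × β → ℝ≥0∞} (hg : Measurable g) :
    ∫⁻ z in S, g z ∂(μ.prod ν) = ∫⁻ y, ∫⁻ x in {x | (x, y) ∈ S}, g (x, y) ∂μ ∂ν := by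
  rw [← lintegral_indicator hS, lintegral_prod_symm _ (hg.indicator hS).aemeasurable]
  congr with y
  have h : MeasurableSet {x | (x, y) ∈ S} := measurable_prodMk_right hS
  rw [← lintegral_indicator h]
  rfl

theorem tendsto_setLIntegral_iUnion {α : Type*} [MeasurableSpace α] {μ : Measure α}
    {S : ℕ → Set α} (hS : Monotone S) (g : α → ℝ≥0∞) :
    Tendsto (fun n => ∫⁻ x in S n, g x ∂μ) atTop (𝓝 (∫⁻ x in ⋃ n, S n, g x ∂μ)) := by
  rw [setLIntegral_iUnion_of_directed g (directed_of_isDirected_le hS)]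
  exact tendsto_atTop_iSup fun m n h => lintegral_mono_set (hS h)

variable {N : ℕ} {s p : ℝ}

/-- The set of pairs `(x, y)` with `|y| < ρ |x|`. -/
def sector (N : ℕ) (ρ : ℝ) : Set (EuclideanSpace ℝ (Fin N) × EuclideanSpace ℝ (Fin N)) :=
  {z | ‖z.2‖ < ρ * ‖z.1‖}

theorem measurableSet_sector (N : ℕ) (ρ : ℝ) : MeasurableSet (sector N ρ) :=
  measurableSet_lt (by fun_prop) (by fun_prop)

theorem ae_ne_zero (hN : 1 ≤ N) : ∀ᵐ x : EuclideanSpace ℝ (Fin N), x ≠ 0 := by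
  have : Nonempty (Fin N) := ⟨⟨0, hN⟩⟩
  exact Measure.ae_ne _ _

/-- The integral over a symmetric function is twice the integral over `|y| < |x|`. -/
theorem lintegral_eq_two_mul_sector (hN : 1 ≤ N)
    {g : EuclideanSpace ℝ (Fin N) × EuclideanSpace ℝ (Fin N) → ℝ≥0∞} (hg : Measurable g)
    (hsymm : ∀ x y, g (x, y) = g (y, x)) :
    ∫⁻ z, g z ∂((volume : Measure (EuclideanSpace ℝ (Fin N))).prod volume)
      = 2 * ∫⁻ z in sector N 1, g z
        ∂((volume : Measure (EuclideanSpace ℝ (Fin N))).prod volume) := by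
  have : Nonempty (Fin N) := ⟨⟨0, hN⟩⟩
  set μ := (volume : Measure (EuclideanSpace ℝ (Fin N)))
  set T : Set (EuclideanSpace ℝ (Fin N) × EuclideanSpace ℝ (Fin N)) := {z | ‖z.1‖ < ‖z.2‖}
  have hT : MeasurableSet T := measurableSet_lt (by fun_prop) (by fun_prop)
  have hdiag : (μ.prod μ) {z | ‖z.1‖ = ‖z.2‖} = 0 := by
    rw [Measure.measure_prod_null (measurableSet_eq_fun (by fun_prop) (by fun_prop))]
    refine Eventually.of_forall fun x => ?_
    have : Prod.mk x ⁻¹' {z : EuclideanSpace ℝ (Fin N) × EuclideanSpace ℝ (Fin N) |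
        ‖z.1‖ = ‖z.2‖} = Metric.sphere 0 ‖x‖ := by
      ext y
      simp [eq_comm]
    beta_reduce
    rw [this, Measure.addHaar_sphere]
    rfl
  have h1 : ∫⁻ z in T, g z ∂(μ.prod μ) = ∫⁻ z in sector N 1, g z ∂(μ.prod μ) := by
    have h := (Measure.measurePreserving_swap (μ := μ) (ν := μ)).setLIntegral_comp_preimage
      (measurableSet_sector N 1) hg
    rw [← h]
    have e : Prod.swap ⁻¹' sector N 1 = T := by
      ext z
      simp [sector, T]
    rw [e]
    congr with z
    exact hsymm _ _
  rw [← lintegral_add_compl g (measurableSet_sector N 1), two_mul]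
  congr 1
  rw [← h1]
  apply setLIntegral_congr
  rw [ae_eq_set]
  constructor
  · refine measure_mono_null (fun z hz => ?_) hdiag
    have h2 : ¬ ‖z.2‖ < 1 * ‖z.1‖ := hz.1
    have h3 : ¬ ‖z.1‖ < ‖z.2‖ := hz.2
    exact le_antisymm (by linarith) (by linarith)
  · refine measure_mono_null (fun z hz => ?_) measure_empty
    have h2 : ‖z.1‖ < ‖z.2‖ := hz.1
    have h3 : ¬ ¬ ‖z.2‖ < 1 * ‖z.1‖ := hz.2
    rw [not_not] at h3
    linarith

/-! ### The constants on the two sides of a sector. -/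

/-- The kernel with a radial weight appearing in the ground state representation. -/
noncomputable def groundKernel (N : ℕ) (s p α : ℝ) (x y : EuclideanSpace ℝ (Fin N)) : ℝ≥0∞ :=
  ENNReal.ofReal (|‖x‖ ^ (-α) - ‖y‖ ^ (-α)| ^ (p - 1)) *
    ENNReal.ofReal (1 / ‖x - y‖ ^ ((N : ℝ) + p * s))

theorem measurable_groundKernel (N : ℕ) (s p α : ℝ) :
    Measurable fun z : EuclideanSpace ℝ (Fin N) × EuclideanSpace ℝ (Fin N) =>
      groundKernel N s p α z.1 z.2 := by
  unfold groundKernel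
  fun_prop

/-- The weight attached to the point with the larger norm, integrated over `|y| < ρ |x|`. -/
noncomputable def innerConst (N : ℕ) (s p α ρ : ℝ) : ℝ≥0∞ :=
  ∫⁻ σ in Ioo (0 : ℝ) ρ, ENNReal.ofReal (σ ^ ((N : ℝ) - 1)) *
    (ENNReal.ofReal (|1 - σ ^ (-α)| ^ (p - 1)) * angularKernel N s p σ)

/-- The weight attached to the point with the smaller norm, integrated over `|y| < ρ |x|`. -/
noncomputable def outerConst (N : ℕ) (s p α ρ : ℝ) : ℝ≥0∞ :=
  ∫⁻ σ in Ioo (0 : ℝ) ρ, ENNReal.ofReal (σ ^ (p * s - 1)) *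
    (ENNReal.ofReal (|1 - σ ^ α| ^ (p - 1)) * angularKernel N s p σ)

/-- Half of the Hardy constant, cut off at `ρ`. -/
noncomputable def cutoffConst (N : ℕ) (s p α ρ : ℝ) : ℝ≥0∞ :=
  ∫⁻ r in Ioo (0 : ℝ) ρ, ENNReal.ofReal (r ^ (p * s - 1) * |1 - r ^ α| ^ p)
    * angularKernel N s p r

theorem setLIntegral_groundKernel_inner (hN : 1 ≤ N) (α : ℝ) {ρ : ℝ} (hρ1 : ρ ≤ 1)
    {x : EuclideanSpace ℝ (Fin N)} (hx : x ≠ 0) :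
    ∫⁻ y in {y | ‖y‖ < ρ * ‖x‖}, groundKernel N s p α x y
      = ENNReal.ofReal (‖x‖ ^ (-(p * s) - α * (p - 1))) * innerConst N s p α ρ := by
  have hR : 0 < ‖x‖ := norm_pos_iff.2 hx
  unfold groundKernel
  rw [setLIntegral_kernel_inner hN s p (f := fun r =>
    ENNReal.ofReal (|‖x‖ ^ (-α) - r ^ (-α)| ^ (p - 1))) (by fun_prop) hρ1 hx,
    Real.rpow_sub hR, div_eq_mul_inv, ENNReal.ofReal_mul (by positivity), mul_assoc]
  congr 1
  rw [innerConst, ← lintegral_const_mul' _ _ ENNReal.ofReal_ne_top]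
  refine setLIntegral_congr_fun measurableSet_Ioo fun σ hσ => ?_
  have e : ENNReal.ofReal (|‖x‖ ^ (-α) - (‖x‖ * σ) ^ (-α)| ^ (p - 1))
      = ENNReal.ofReal ((‖x‖ ^ (α * (p - 1)))⁻¹) * ENNReal.ofReal (|1 - σ ^ (-α)| ^ (p - 1)) := by
    rw [← ENNReal.ofReal_mul (by positivity), Real.mul_rpow hR.le hσ.1.le]
    congr 1
    rw [show ‖x‖ ^ (-α) - ‖x‖ ^ (-α) * σ ^ (-α) = ‖x‖ ^ (-α) * (1 - σ ^ (-α)) by ring, abs_mul,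
      abs_of_pos (by positivity), Real.mul_rpow (by positivity) (abs_nonneg _), ← Real.rpow_mul hR.le,
      neg_mul, Real.rpow_neg hR.le]
  rw [e]
  ring

theorem setLIntegral_groundKernel_outer (hN : 1 ≤ N) (α : ℝ) {ρ : ℝ} (hρ : 0 < ρ) (hρ1 : ρ ≤ 1)
    {y : EuclideanSpace ℝ (Fin N)} (hy : y ≠ 0) :
    ∫⁻ x in {x | ‖y‖ < ρ * ‖x‖}, groundKernel N s p α x y
      = ENNReal.ofReal (‖y‖ ^ (-(p * s) - α * (p - 1))) * outerConst N s p α ρ := by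
  have hR : 0 < ‖y‖ := norm_pos_iff.2 hy
  unfold groundKernel
  simp only [norm_sub_rev _ y]
  rw [setLIntegral_kernel_outer hN s p (f := fun r =>
    ENNReal.ofReal (|r ^ (-α) - ‖y‖ ^ (-α)| ^ (p - 1))) (by fun_prop) hρ hρ1 hy,
    Real.rpow_sub hR, div_eq_mul_inv, ENNReal.ofReal_mul (by positivity), mul_assoc]
  congr 1
  rw [outerConst, ← lintegral_const_mul' _ _ ENNReal.ofReal_ne_top]
  refine setLIntegral_congr_fun measurableSet_Ioo fun σ hσ => ?_
  have hσ0 := hσ.1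
  have e : ENNReal.ofReal (|(‖y‖ / σ) ^ (-α) - ‖y‖ ^ (-α)| ^ (p - 1))
      = ENNReal.ofReal ((‖y‖ ^ (α * (p - 1)))⁻¹) * ENNReal.ofReal (|1 - σ ^ α| ^ (p - 1)) := by
    rw [← ENNReal.ofReal_mul (by positivity), Real.div_rpow hR.le hσ0.le, Real.rpow_neg hσ0.le,
      div_inv_eq_mul]
    congr 1
    rw [show ‖y‖ ^ (-α) * σ ^ α - ‖y‖ ^ (-α) = -(‖y‖ ^ (-α) * (1 - σ ^ α)) by ring, abs_neg, abs_mul,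
      abs_of_pos (by positivity), Real.mul_rpow (by positivity) (abs_nonneg _), ← Real.rpow_mul hR.le,
      neg_mul, Real.rpow_neg hR.le]
  rw [e]
  ring

theorem measurable_angularKernel (N : ℕ) (s p : ℝ) : Measurable (angularKernel N s p) := by
  unfold angularKernel
  split_ifs
  · fun_prop
  · apply Measurable.const_mul
    exact Measurable.lintegral_prod_right' (f := fun z : ℝ × ℝ => ENNReal.ofReal
      ((1 - z.2 ^ 2) ^ (((N : ℝ) - 3) / 2)
        / (1 - 2 * z.1 * z.2 + z.1 ^ 2) ^ (((N : ℝ) + p * s) / 2))) (by fun_prop)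

/-- Here the Hardy constant emerges. Since `N - 1 = ps - 1 + αp`, the inner integrand is `σ^α` times
the outer one, and the difference contributes one more factor `1 - σ^α`. -/
theorem outerConst_eq_add {α : ℝ} (hαp : 0 < α) (ρ : ℝ) (hρ1 : ρ ≤ 1) (hp : 2 ≤ p)
    (hα : α = ((N : ℝ) - p * s) / p) :
    outerConst N s p α ρ = innerConst N s p α ρ + cutoffConst N s p α ρ := by
  have hm := measurable_angularKernel N s p
  unfold outerConst innerConst cutoffConst
  rw [← lintegral_add_left (by fun_prop)]
  refine setLIntegral_congr_fun measurableSet_Ioo fun σ hσ => ?_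
  have hσ0 := hσ.1
  have hNα : (N : ℝ) - 1 = p * s - 1 + α * p := by rw [hα]; field_simp; ring
  have h1 : σ ^ α < 1 := Real.rpow_lt_one hσ0.le (hσ.2.trans_le hρ1) hαp
  have hpos : 0 < 1 - σ ^ α := by linarith
  rw [← mul_assoc, ← mul_assoc, ← ENNReal.ofReal_mul (by positivity),
    ← ENNReal.ofReal_mul (by positivity), ← add_mul, ← ENNReal.ofReal_add (by positivity)
    (by positivity)]
  congr 2
  have e1 : |1 - σ ^ (-α)| = σ ^ (-α) * |1 - σ ^ α| := by
    rw [show 1 - σ ^ (-α) = -(σ ^ (-α) * (1 - σ ^ α)) by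
      rw [mul_sub, ← Real.rpow_add hσ0]; simp, abs_neg, abs_mul, abs_of_pos (by positivity)]
  rw [e1, Real.mul_rpow (by positivity) (abs_nonneg _), ← Real.rpow_mul hσ0.le, abs_of_pos hpos,
    ← mul_assoc, ← Real.rpow_add hσ0, hNα,
    show p * s - 1 + α * p + -α * (p - 1) = p * s - 1 + α by ring, Real.rpow_add hσ0,
    Real.rpow_sub_one hpos.ne']
  field_simp
  ring

/-- The same relation when `ω` increases with `|x|`: `σ^α > 1` now, so the roles of the two
constants are exchanged. -/
theorem innerConst_eq_add {α : ℝ} (hαn : α < 0) (ρ : ℝ) (hρ1 : ρ ≤ 1) (hp : 2 ≤ p)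
    (hα : α = ((N : ℝ) - p * s) / p) :
    innerConst N s p α ρ = outerConst N s p α ρ + cutoffConst N s p α ρ := by
  have hm := measurable_angularKernel N s p
  unfold outerConst innerConst cutoffConst
  rw [← lintegral_add_left (by fun_prop)]
  refine setLIntegral_congr_fun measurableSet_Ioo fun σ hσ => ?_
  have hσ0 := hσ.1
  have hNα : (N : ℝ) - 1 = p * s - 1 + α * p := by rw [hα]; field_simp; ring
  have h1 : 1 < σ ^ α := Real.one_lt_rpow_of_pos_of_lt_one_of_neg hσ0 (hσ.2.trans_le hρ1) hαn
  have hpos : 0 < σ ^ α - 1 := by linarith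
  rw [← mul_assoc, ← mul_assoc, ← ENNReal.ofReal_mul (by positivity),
    ← ENNReal.ofReal_mul (by positivity), ← add_mul, ← ENNReal.ofReal_add (by positivity)
    (by positivity)]
  congr 2
  have e1 : |1 - σ ^ (-α)| = σ ^ (-α) * |1 - σ ^ α| := by
    rw [show 1 - σ ^ (-α) = -(σ ^ (-α) * (1 - σ ^ α)) by
      rw [mul_sub, ← Real.rpow_add hσ0]; simp, abs_neg, abs_mul, abs_of_pos (by positivity)]
  rw [e1, Real.mul_rpow (by positivity) (abs_nonneg _), ← Real.rpow_mul hσ0.le, abs_sub_comm,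
    abs_of_pos hpos,
    ← mul_assoc, ← Real.rpow_add hσ0, hNα,
    show p * s - 1 + α * p + -α * (p - 1) = p * s - 1 + α by ring, Real.rpow_add hσ0,
    Real.rpow_sub_one hpos.ne']
  field_simp
  ring

/-- The constant is the integral of `groundKernel` at a unit vector over `|y| < ρ`, where `|x - y| ≥
1 - ρ`. Only the singularity of the weight at the origin is left, and it is integrable. -/
theorem innerConst_lt_top (hN : 1 ≤ N) (hs0 : 0 < s) {α : ℝ} (hα0 : α ≠ 0) {ρ : ℝ}
    (hρ : 0 < ρ) (hρ1 : ρ < 1) (hp : 2 ≤ p) (hα : α = ((N : ℝ) - p * s) / p) :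
    innerConst N s p α ρ < ⊤ := by
  obtain ⟨d, rfl⟩ : ∃ d, N = d + 1 := ⟨N - 1, by omega⟩
  set x : EuclideanSpace ℝ (Fin (d + 1)) := EuclideanSpace.single 0 1
  have hx1 : ‖x‖ = 1 := by simp [x]
  have hx : x ≠ 0 := by rw [← norm_pos_iff, hx1]; exact one_pos
  have hκ : 0 < ((d + 1 : ℕ) : ℝ) + p * s := by positivity
  have h1 := setLIntegral_groundKernel_inner (s := s) (p := p) hN α hρ1.le hx
  rw [hx1, Real.one_rpow, ENNReal.ofReal_one, one_mul, mul_one] at h1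
  rw [← h1]
  let f : ℝ → ℝ≥0∞ := fun r => ENNReal.ofReal (|1 - r ^ (-α)| ^ (p - 1))
  have hf : Measurable f := by fun_prop
  calc ∫⁻ y in {y | ‖y‖ < ρ}, groundKernel (d + 1) s p α x y
      ≤ ∫⁻ y in {y : EuclideanSpace ℝ (Fin (d + 1)) | ‖y‖ < ρ},
          ENNReal.ofReal (1 / (1 - ρ) ^ (((d + 1 : ℕ) : ℝ) + p * s)) * f ‖y‖ := by
        refine setLIntegral_mono' (measurableSet_lt measurable_norm measurable_const) fun y hy => ?_
        have hy : ‖y‖ < ρ := hy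
        have h2 : 1 - ρ ≤ ‖x - y‖ := by
          have := norm_sub_norm_le x y
          linarith
        have h3 : 0 < 1 - ρ := by linarith
        rw [groundKernel, hx1, Real.one_rpow, mul_comm]
        gcongr
    _ = ENNReal.ofReal (1 / (1 - ρ) ^ (((d + 1 : ℕ) : ℝ) + p * s)) *
          ∫⁻ y : EuclideanSpace ℝ (Fin (d + 1)), (Iio ρ).indicator f ‖y‖ := by
        rw [lintegral_const_mul _ (by fun_prop),
          ← lintegral_indicator (measurableSet_lt measurable_norm measurable_const)]
        rfl
    _ < ⊤ := by
        refine ENNReal.mul_lt_top ENNReal.ofReal_lt_top ?_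
        rw [lintegral_radial hN (hf.indicator measurableSet_Iio)]
        refine ENNReal.mul_lt_top (measure_lt_top _ _) ?_
        -- For `α < 0` the weight is bounded and `b = d`. For `α > 0` the exponent is `d - α(p - 1)
        -- = ps + α - 1 > -1`.
        obtain ⟨b, hb, hfb⟩ : ∃ b : ℝ, -1 < b ∧ ∀ r ∈ Ioo (0 : ℝ) 1,
            r ^ d * |1 - r ^ (-α)| ^ (p - 1) ≤ r ^ b := by
          have hαp : α * (p - 1) = ((d + 1 : ℕ) : ℝ) - p * s - α := by rw [hα]; field_simp
          rcases lt_or_gt_of_ne hα0 with hneg | hpos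
          · refine ⟨d, by linarith [(Nat.cast_nonneg d : (0 : ℝ) ≤ d)], fun r hr => ?_⟩
            rw [Real.rpow_natCast]
            have h1 : r ^ (-α) ≤ 1 := Real.rpow_le_one hr.1.le hr.2.le (by linarith)
            have h2 : 0 < r ^ (-α) := Real.rpow_pos_of_pos hr.1 _
            have h3 : |1 - r ^ (-α)| ^ (p - 1) ≤ 1 :=
              Real.rpow_le_one (abs_nonneg _) (abs_le.2 ⟨by linarith, by linarith⟩) (by linarith)
            exact mul_le_of_le_one_right (pow_nonneg hr.1.le _) h3
          · refine ⟨d - α * (p - 1), ?_, fun r hr => ?_⟩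
            · rw [hαp]
              push_cast
              have : 0 < p * s := by positivity
              linarith
            · have h1 : 1 ≤ r ^ (-α) :=
                Real.one_le_rpow_of_pos_of_le_one_of_nonpos hr.1 hr.2.le (by linarith)
              have h3 : |1 - r ^ (-α)| ^ (p - 1) ≤ (r ^ (-α)) ^ (p - 1) :=
                Real.rpow_le_rpow (abs_nonneg _) (abs_le.2 ⟨by linarith, by linarith⟩) (by linarith)
              have h0 := hr.1
              calc r ^ d * |1 - r ^ (-α)| ^ (p - 1) ≤ r ^ d * (r ^ (-α)) ^ (p - 1) := by gcongr
                _ = r ^ (d - α * (p - 1)) := by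
                  rw [← Real.rpow_mul h0.le, ← Real.rpow_natCast, ← Real.rpow_add h0]
                  ring_nf
        have hint : IntegrableOn (fun r : ℝ => r ^ b) (Ioo 0 1) :=
          (intervalIntegral.integrableOn_Ioo_rpow_iff one_pos).2 hb
        refine lt_of_le_of_lt ?_ hint.lintegral_lt_top
        rw [← lintegral_indicator measurableSet_Ioi, ← lintegral_indicator measurableSet_Ioo]
        refine lintegral_mono fun r => ?_
        by_cases h0 : 0 < r
        · by_cases h2 : r < ρ
          · have hr : r ∈ Ioo (0 : ℝ) 1 := ⟨h0, h2.trans hρ1⟩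
            rw [indicator_of_mem (show r ∈ Ioi 0 from h0), indicator_of_mem hr,
              indicator_of_mem (show r ∈ Iio ρ from h2), Nat.add_sub_cancel,
              ← ENNReal.ofReal_mul (by positivity)]
            exact ENNReal.ofReal_le_ofReal (hfb r hr)
          · simp [h0, h2]
        · simp [h0]

/-! ### The remainder of the ground state representation. -/

/-- The odd extension of `d ↦ d ^ (p - 1)`. -/
noncomputable def signedPow (p d : ℝ) : ℝ := SignType.sign d * |d| ^ (p - 1)

theorem signedPow_of_pos {d : ℝ} (hd : 0 < d) : signedPow p d = d ^ (p - 1) := by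
  simp [signedPow, sign_pos hd, abs_of_pos hd]

theorem signedPow_neg (p d : ℝ) : signedPow p (-d) = -signedPow p d := by
  simp [signedPow, Left.sign_neg]

theorem measurable_signedPow (p : ℝ) : Measurable (signedPow p) := by
  have h : signedPow p = fun d => if 0 < d then d ^ (p - 1) else if d < 0 then -(-d) ^ (p - 1)
      else 0 := by
    funext d
    rcases lt_trichotomy d 0 with h | rfl | h
    · rw [if_neg h.not_gt, if_pos h, ← signedPow_of_pos (neg_pos.2 h), signedPow_neg, neg_neg]
    · simp [signedPow]
    · rw [if_pos h, signedPow_of_pos h]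
  rw [h]
  refine Measurable.ite measurableSet_Ioi (by fun_prop) ?_
  exact Measurable.ite measurableSet_Iio (by fun_prop) (by fun_prop)

/-- The density `|u|^p ω^(1-p)` with respect to the ground state `ω = |x|^(-α)`. -/
noncomputable def groundDensity (p α : ℝ) (u : EuclideanSpace ℝ (Fin N) → ℂ)
    (x : EuclideanSpace ℝ (Fin N)) : ℝ :=
  ‖u x‖ ^ p * ‖x‖ ^ (α * (p - 1))

theorem groundDensity_nonneg (p α : ℝ) (u : EuclideanSpace ℝ (Fin N) → ℂ)
    (x : EuclideanSpace ℝ (Fin N)) : 0 ≤ groundDensity p α u x := by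
  unfold groundDensity
  positivity

/-- The numerator of the remainder in the ground state representation. -/
noncomputable def groundRemainder (p α : ℝ) (u : EuclideanSpace ℝ (Fin N) → ℂ)
    (x y : EuclideanSpace ℝ (Fin N)) : ℝ :=
  ‖u x - u y‖ ^ p - signedPow p (‖x‖ ^ (-α) - ‖y‖ ^ (-α)) *
    (groundDensity p α u x - groundDensity p α u y)

theorem groundRemainder_comm (p α : ℝ) (u : EuclideanSpace ℝ (Fin N) → ℂ)
    (x y : EuclideanSpace ℝ (Fin N)) : groundRemainder p α u x y = groundRemainder p α u y x := by
  unfold groundRemainder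
  rw [norm_sub_rev, ← neg_sub (‖y‖ ^ (-α)), signedPow_neg]
  ring

theorem groundDensity_eq {α : ℝ} {u v : EuclideanSpace ℝ (Fin N) → ℂ}
    {x : EuclideanSpace ℝ (Fin N)} (hx : x ≠ 0) (hv : v x = ((‖x‖ ^ α : ℝ) : ℂ) * u x) :
    groundDensity p α u x = ‖x‖ ^ (-α) * ‖v x‖ ^ p := by
  have h : 0 < ‖x‖ := norm_pos_iff.2 hx
  rw [groundDensity, hv, norm_mul, Complex.norm_real, Real.norm_of_nonneg (by positivity),
    Real.mul_rpow (by positivity) (norm_nonneg _), ← Real.rpow_mul h.le, ← mul_assoc,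
    ← Real.rpow_add h, mul_comm]
  ring_nf

theorem ground_mul_eq {α : ℝ} {u v : EuclideanSpace ℝ (Fin N) → ℂ}
    {x : EuclideanSpace ℝ (Fin N)} (hx : x ≠ 0) (hv : v x = ((‖x‖ ^ α : ℝ) : ℂ) * u x) :
    u x = ((‖x‖ ^ (-α) : ℝ) : ℂ) * v x := by
  have h : 0 < ‖x‖ := norm_pos_iff.2 hx
  rw [hv, ← mul_assoc, ← Complex.ofReal_mul, ← Real.rpow_add h]
  simp

/-- The pointwise inequality with `a = ω(x)`, `b = ω(y)`, after ordering the two weights. When they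
coincide, the remainder is exactly `a^p |v(x) - v(y)|^p`, and `c_p ≤ 1` is what is needed. -/
theorem le_groundRemainder (hp : 2 ≤ p) {α : ℝ} {u v : EuclideanSpace ℝ (Fin N) → ℂ}
    {x y : EuclideanSpace ℝ (Fin N)} (hx : x ≠ 0) (hy : y ≠ 0)
    (hvx : v x = ((‖x‖ ^ α : ℝ) : ℂ) * u x) (hvy : v y = ((‖y‖ ^ α : ℝ) : ℂ) * u y) :
    remainderConst p * ((‖x‖ ^ (-α) * ‖y‖ ^ (-α)) ^ (p / 2) * ‖v x - v y‖ ^ p)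
      ≤ groundRemainder p α u x y := by
  have hx0 : 0 < ‖x‖ := norm_pos_iff.2 hx
  have hy0 : 0 < ‖y‖ := norm_pos_iff.2 hy
  have key : ∀ x y : EuclideanSpace ℝ (Fin N), x ≠ 0 → y ≠ 0 →
      v x = ((‖x‖ ^ α : ℝ) : ℂ) * u x → v y = ((‖y‖ ^ α : ℝ) : ℂ) * u y →
      ‖y‖ ^ (-α) < ‖x‖ ^ (-α) →
      remainderConst p * ((‖x‖ ^ (-α) * ‖y‖ ^ (-α)) ^ (p / 2) * ‖v x - v y‖ ^ p)
        ≤ groundRemainder p α u x y := by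
    intro x y hx hy hvx hvy hlt
    have hy0 : 0 < ‖y‖ := norm_pos_iff.2 hy
    have h := norm_mul_sub_mul_rpow_ge hp (by positivity) hlt (v x) (v y)
    rw [groundRemainder, groundDensity_eq hx hvx, groundDensity_eq hy hvy,
      signedPow_of_pos (by linarith)]
    rw [← ground_mul_eq hx hvx, ← ground_mul_eq hy hvy] at h
    linarith
  rcases lt_trichotomy (‖x‖ ^ (-α)) (‖y‖ ^ (-α)) with h | h | h
  · rw [groundRemainder_comm, norm_sub_rev (v x), mul_comm (‖x‖ ^ (-α))]
    exact key y x hy hx hvy hvx h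
  · have e : u x - u y = ((‖y‖ ^ (-α) : ℝ) : ℂ) * (v x - v y) := by
      rw [ground_mul_eq hx hvx, ground_mul_eq hy hvy, h]
      ring
    have hw : 0 < ‖y‖ ^ (-α) := by positivity
    have e2 : (‖y‖ ^ (-α) * ‖y‖ ^ (-α)) ^ (p / 2) = (‖y‖ ^ (-α)) ^ p := by
      rw [Real.mul_rpow hw.le hw.le, ← Real.rpow_add hw]
      ring_nf
    rw [groundRemainder, h, sub_self, e, norm_mul, Complex.norm_real, Real.norm_of_nonneg hw.le,
      Real.mul_rpow hw.le (norm_nonneg _), e2]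
    simp only [signedPow, sign_zero, SignType.coe_zero, zero_mul, sub_zero]
    exact mul_le_of_le_one_left (by positivity) (remainderConst_le_one hp)
  · exact key x y hx hy hvx hvy h

theorem groundRemainder_two {α : ℝ} {u v : EuclideanSpace ℝ (Fin N) → ℂ}
    {x y : EuclideanSpace ℝ (Fin N)} (hx : x ≠ 0) (hy : y ≠ 0)
    (hvx : v x = ((‖x‖ ^ α : ℝ) : ℂ) * u x) (hvy : v y = ((‖y‖ ^ α : ℝ) : ℂ) * u y) :
    groundRemainder 2 α u x y
      = (‖x‖ ^ (-α) * ‖y‖ ^ (-α)) ^ ((2 : ℝ) / 2) * ‖v x - v y‖ ^ (2 : ℝ) := by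
  have hs : ∀ d : ℝ, signedPow 2 d = d := by
    intro d
    rw [signedPow, show (2 : ℝ) - 1 = 1 by norm_num, Real.rpow_one, mul_comm, abs_mul_sign]
  rw [groundRemainder, groundDensity_eq hx hvx, groundDensity_eq hy hvy, hs]
  have h := norm_mul_sub_mul_sq (a := ‖x‖ ^ (-α)) (b := ‖y‖ ^ (-α)) (v x) (v y)
  rw [← ground_mul_eq hx hvx, ← ground_mul_eq hy hvy] at h
  norm_num
  linarith

theorem groundRemainder_nonneg (hp : 2 ≤ p) (α : ℝ) (u : EuclideanSpace ℝ (Fin N) → ℂ)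
    {x y : EuclideanSpace ℝ (Fin N)} (hx : x ≠ 0) (hy : y ≠ 0) :
    0 ≤ groundRemainder p α u x y := by
  refine le_trans ?_ (le_groundRemainder hp (v := fun x => ((‖x‖ ^ α : ℝ) : ℂ) * u x) hx hy rfl rfl)
  have := remainderConst_pos hp
  positivity

theorem ofReal_groundDensity_mul {α : ℝ} (u : EuclideanSpace ℝ (Fin N) → ℂ)
    {x : EuclideanSpace ℝ (Fin N)} (hx : x ≠ 0) :
    ENNReal.ofReal (groundDensity p α u x) * ENNReal.ofReal (‖x‖ ^ (-(p * s) - α * (p - 1)))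
      = ENNReal.ofReal (‖u x‖ ^ p / ‖x‖ ^ (p * s)) := by
  have h : 0 < ‖x‖ := norm_pos_iff.2 hx
  rw [← ENNReal.ofReal_mul (groundDensity_nonneg _ _ _ _), groundDensity, mul_assoc,
    ← Real.rpow_add h, div_eq_mul_inv, ← Real.rpow_neg h.le]
  ring_nf

/-- Integrating out `y` leaves a power of `|x|` which turns the density `|u|^p ω^(1-p)` into `|u|^p
|x|^(-ps)`. -/
theorem lintegral_sector_inner (hN : 1 ≤ N) (α : ℝ) {ρ : ℝ} (hρ1 : ρ ≤ 1)
    {u : EuclideanSpace ℝ (Fin N) → ℂ} (hu : Measurable u) :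
    ∫⁻ z in sector N ρ, ENNReal.ofReal (groundDensity p α u z.1) * groundKernel N s p α z.1 z.2
      ∂((volume : Measure (EuclideanSpace ℝ (Fin N))).prod volume)
      = hardyIntegral N s p u * innerConst N s p α ρ := by
  have hk := measurable_groundKernel N s p α
  rw [setLIntegral_prod_section (measurableSet_sector N ρ)
    (by unfold groundDensity; fun_prop), hardyIntegral, ← lintegral_mul_const _ (by fun_prop)]
  refine lintegral_congr_ae ?_
  filter_upwards [ae_ne_zero hN] with x hx
  rw [lintegral_const_mul' _ _ ENNReal.ofReal_ne_top, ← ofReal_groundDensity_mul (α := α) u hx,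
    mul_assoc, ← setLIntegral_groundKernel_inner hN α hρ1 hx]
  rfl

theorem lintegral_sector_outer (hN : 1 ≤ N) (α : ℝ) {ρ : ℝ} (hρ : 0 < ρ) (hρ1 : ρ ≤ 1)
    {u : EuclideanSpace ℝ (Fin N) → ℂ} (hu : Measurable u) :
    ∫⁻ z in sector N ρ, ENNReal.ofReal (groundDensity p α u z.2) * groundKernel N s p α z.1 z.2
      ∂((volume : Measure (EuclideanSpace ℝ (Fin N))).prod volume)
      = hardyIntegral N s p u * outerConst N s p α ρ := by
  have hk := measurable_groundKernel N s p α
  rw [setLIntegral_prod_section_symm (measurableSet_sector N ρ)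
    (by unfold groundDensity; fun_prop), hardyIntegral, ← lintegral_mul_const _ (by fun_prop)]
  refine lintegral_congr_ae ?_
  filter_upwards [ae_ne_zero hN] with y hy
  rw [lintegral_const_mul' _ _ ENNReal.ofReal_ne_top, ← ofReal_groundDensity_mul (α := α) u hy,
    mul_assoc, ← setLIntegral_groundKernel_outer hN α hρ hρ1 hy]
  rfl

/-- The density of the remainder in the ground state representation. -/
noncomputable def remainderDensity (N : ℕ) (s p α : ℝ) (u : EuclideanSpace ℝ (Fin N) → ℂ)
    (z : EuclideanSpace ℝ (Fin N) × EuclideanSpace ℝ (Fin N)) : ℝ≥0∞ :=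
  ENNReal.ofReal (groundRemainder p α u z.1 z.2 / ‖z.1 - z.2‖ ^ ((N : ℝ) + p * s))

theorem measurable_remainderDensity (α : ℝ) {u : EuclideanSpace ℝ (Fin N) → ℂ}
    (hu : Measurable u) : Measurable (remainderDensity N s p α u) := by
  have := measurable_signedPow p
  unfold remainderDensity groundRemainder groundDensity
  fun_prop

theorem ae_prod_ne_zero (hN : 1 ≤ N) :
    ∀ᵐ z ∂((volume : Measure (EuclideanSpace ℝ (Fin N))).prod
      (volume : Measure (EuclideanSpace ℝ (Fin N)))), z.1 ≠ 0 ∧ z.2 ≠ 0 :=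
  (Measure.quasiMeasurePreserving_fst.ae (ae_ne_zero hN)).and
    (Measure.quasiMeasurePreserving_snd.ae (ae_ne_zero hN))

/-- The definition of the remainder rearranged without subtraction, so that it can be integrated in
`[0, ∞]`. -/
theorem remainderDensity_add {α : ℝ} (hp : 2 ≤ p) (u : EuclideanSpace ℝ (Fin N) → ℂ)
    {x y : EuclideanSpace ℝ (Fin N)} (hx : x ≠ 0) (hy : y ≠ 0)
    (hlt : ‖x‖ ^ (-α) < ‖y‖ ^ (-α)) :
    remainderDensity N s p α u (x, y)
        + ENNReal.ofReal (groundDensity p α u y) * groundKernel N s p α x y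
      = ENNReal.ofReal (‖u x - u y‖ ^ p / ‖x - y‖ ^ ((N : ℝ) + p * s))
        + ENNReal.ofReal (groundDensity p α u x) * groundKernel N s p α x y := by
  have hr := groundRemainder_nonneg hp α u hx hy
  have h1 := groundDensity_nonneg p α u x
  have h2 := groundDensity_nonneg p α u y
  unfold remainderDensity groundKernel
  rw [← ENNReal.ofReal_mul (by positivity), ← ENNReal.ofReal_mul h2, ← ENNReal.ofReal_mul h1,
    ← ENNReal.ofReal_add (by positivity) (by positivity),
    ← ENNReal.ofReal_add (by positivity) (by positivity)]
  congr 1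
  have hs : signedPow p (‖x‖ ^ (-α) - ‖y‖ ^ (-α)) = -|‖x‖ ^ (-α) - ‖y‖ ^ (-α)| ^ (p - 1) := by
    rw [← neg_sub, signedPow_neg, signedPow_of_pos (by linarith), abs_neg,
      abs_of_pos (by linarith)]
  rw [groundRemainder, hs]
  ring

theorem groundKernel_comm (α : ℝ) (x y : EuclideanSpace ℝ (Fin N)) :
    groundKernel N s p α x y = groundKernel N s p α y x := by
  unfold groundKernel
  rw [abs_sub_comm, norm_sub_rev]

/-- The common part `H * K₁` can be cancelled only because it is finite. This is why the sector is
cut off at `ρ < 1`. -/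
theorem hardyIntegral_mul_eq_of_add_eq {H K₁ K₂ C E R : ℝ≥0∞} (hH : H ≠ ⊤) (hK : K₁ ≠ ⊤)
    (h : R + H * K₂ = E + H * K₁) (hadd : K₂ = K₁ + C) : E = C * H + R := by
  rw [hadd, mul_add] at h
  have h1 : H * K₁ ≠ ⊤ := ENNReal.mul_ne_top hH hK
  have h2 : (C * H + R) + H * K₁ = E + H * K₁ := by rw [← h]; ring
  exact ((ENNReal.add_left_inj h1).1 h2).symm

/-- The ground state representation with the cut-off `|y| < ρ |x|`. -/
theorem energy_sector_eq (hN : 1 ≤ N) (hs0 : 0 < s) (hp : 2 ≤ p) {α : ℝ}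
    (hα : α = ((N : ℝ) - p * s) / p) (hα0 : α ≠ 0) {ρ : ℝ} (hρ : 0 < ρ) (hρ1 : ρ < 1)
    {u : EuclideanSpace ℝ (Fin N) → ℂ} (hu : Measurable u) (hH : hardyIntegral N s p u ≠ ⊤) :
    ∫⁻ z in sector N ρ, ENNReal.ofReal (‖u z.1 - u z.2‖ ^ p / ‖z.1 - z.2‖ ^ ((N : ℝ) + p * s))
      ∂((volume : Measure (EuclideanSpace ℝ (Fin N))).prod volume)
      = cutoffConst N s p α ρ * hardyIntegral N s p u +
        ∫⁻ z in sector N ρ, remainderDensity N s p α u z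
          ∂((volume : Measure (EuclideanSpace ℝ (Fin N))).prod volume) := by
  have hI := lintegral_sector_inner (s := s) (p := p) hN α hρ1.le hu
  have hO := lintegral_sector_outer (s := s) (p := p) hN α hρ hρ1.le hu
  have hIfin := innerConst_lt_top hN hs0 hα0 hρ hρ1 hp hα
  have hm := measurable_remainderDensity (s := s) (p := p) α hu
  have hmE : Measurable fun z : EuclideanSpace ℝ (Fin N) × EuclideanSpace ℝ (Fin N) =>
      ENNReal.ofReal (‖u z.1 - u z.2‖ ^ p / ‖z.1 - z.2‖ ^ ((N : ℝ) + p * s)) := by fun_prop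
  have hlt : ∀ z ∈ sector N ρ, z.1 ≠ 0 → z.2 ≠ 0 → ‖z.2‖ < ‖z.1‖ := by
    intro z hz h1 _
    have h : ‖z.2‖ < ρ * ‖z.1‖ := hz
    have := norm_pos_iff.2 h1
    nlinarith
  -- The sign of `α` decides which point of the sector carries the larger weight `ω`. For `α < 0` it
  -- is the one of larger norm, and the identity is used with the two points exchanged.
  rcases lt_or_gt_of_ne hα0 with hneg | hpos
  · have hadd := innerConst_eq_add hneg ρ hρ1.le hp hα
    refine hardyIntegral_mul_eq_of_add_eq hH (K₁ := outerConst N s p α ρ) ?_ ?_ hadd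
    · exact ne_top_of_le_ne_top hIfin.ne (hadd ▸ le_self_add)
    · rw [← hI, ← hO, ← lintegral_add_left hm, ← lintegral_add_left hmE]
      refine setLIntegral_congr_fun_ae (measurableSet_sector N ρ) ?_
      filter_upwards [ae_prod_ne_zero hN] with z hz hzS
      have h := remainderDensity_add (s := s) hp u hz.2 hz.1 (α := α)
        (Real.rpow_lt_rpow (norm_nonneg _) (hlt z hzS hz.1 hz.2) (by linarith))
      have e : remainderDensity N s p α u (z.2, z.1) = remainderDensity N s p α u z := by
        unfold remainderDensity
        rw [groundRemainder_comm, norm_sub_rev]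
      rw [e, groundKernel_comm, norm_sub_rev, norm_sub_rev z.2] at h
      exact h
  · have hadd := outerConst_eq_add hpos ρ hρ1.le hp hα
    refine hardyIntegral_mul_eq_of_add_eq hH hIfin.ne ?_ hadd
    rw [← hI, ← hO, ← lintegral_add_left hm, ← lintegral_add_left hmE]
    refine setLIntegral_congr_fun_ae (measurableSet_sector N ρ) ?_
    filter_upwards [ae_prod_ne_zero hN] with z hz hzS
    exact remainderDensity_add hp u hz.1 hz.2 (Real.rpow_lt_rpow_of_neg (norm_pos_iff.2 hz.2)
      (hlt z hzS hz.1 hz.2) (by linarith))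

theorem exists_cutoff_seq : ∃ ρ : ℕ → ℝ, Monotone ρ ∧ (∀ n, 0 < ρ n ∧ ρ n < 1) ∧
    ∀ a : ℝ, a < 1 → ∃ n, a < ρ n := by
  -- The shift by `2` makes the first term `1/2` rather than `0`.
  refine ⟨fun n => 1 - 1 / ((n : ℝ) + 2), fun m n h => ?_, fun n => ⟨?_, ?_⟩, fun a ha => ?_⟩
  · have : (m : ℝ) ≤ n := by exact_mod_cast h
    have : 1 / ((n : ℝ) + 2) ≤ 1 / ((m : ℝ) + 2) := by gcongr
    change 1 - 1 / ((m : ℝ) + 2) ≤ 1 - 1 / ((n : ℝ) + 2)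
    linarith
  · have : 1 / ((n : ℝ) + 2) < 1 := by
      rw [div_lt_one (by positivity)]
      have : (0 : ℝ) ≤ n := by positivity
      linarith
    linarith
  · have : 0 < 1 / ((n : ℝ) + 2) := by positivity
    linarith
  · obtain ⟨n, hn⟩ := exists_nat_one_div_lt (show 0 < 1 - a by linarith)
    refine ⟨n, ?_⟩
    have : 1 / ((n : ℝ) + 2) ≤ 1 / ((n : ℝ) + 1) := by gcongr; linarith
    linarith

/-- The ground state representation of the fractional energy. -/
theorem energy_eq_add_remainder (hN : 1 ≤ N) (hs0 : 0 < s) (hp : 2 ≤ p)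
    (hα0 : ((N : ℝ) - p * s) / p ≠ 0)
    {u : EuclideanSpace ℝ (Fin N) → ℂ} (hu : Measurable u) (hH : hardyIntegral N s p u ≠ ⊤) :
    energy N s p u = hardyConst N s p * hardyIntegral N s p u +
      ∫⁻ z, remainderDensity N s p (((N : ℝ) - p * s) / p) u z
        ∂((volume : Measure (EuclideanSpace ℝ (Fin N))).prod volume) := by
  set α := ((N : ℝ) - p * s) / p with hα
  obtain ⟨ρ, hmono, hρ, hsup⟩ := exists_cutoff_seq
  have hSmono : Monotone fun n => sector N (ρ n) := by
    intro m n h z hz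
    have hz : ‖z.2‖ < ρ m * ‖z.1‖ := hz
    exact hz.trans_le (mul_le_mul_of_nonneg_right (hmono h) (norm_nonneg _))
  have hSU : ⋃ n, sector N (ρ n) = sector N 1 := by
    ext z
    rw [mem_iUnion]
    constructor
    · rintro ⟨n, hz⟩
      have hz : ‖z.2‖ < ρ n * ‖z.1‖ := hz
      exact hz.trans_le (mul_le_mul_of_nonneg_right (hρ n).2.le (norm_nonneg _))
    · intro hz
      have hz : ‖z.2‖ < 1 * ‖z.1‖ := hz
      have h1 : 0 < ‖z.1‖ := by
        have := norm_nonneg z.2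
        linarith
      obtain ⟨n, hn⟩ := hsup (‖z.2‖ / ‖z.1‖) (by rw [div_lt_one h1]; linarith)
      exact ⟨n, (div_lt_iff₀ h1).1 hn⟩
  have hImono : Monotone fun n => Ioo 0 (ρ n) := fun m n h => Ioo_subset_Ioo_right (hmono h)
  have hIU : ⋃ n, Ioo 0 (ρ n) = Ioo 0 1 := by
    ext r
    simp only [mem_iUnion, mem_Ioo, exists_and_left]
    exact and_congr_right fun _ => ⟨fun ⟨n, hn⟩ => hn.trans (hρ n).2, fun h => hsup r h⟩
  have hC : Tendsto (fun n => cutoffConst N s p α (ρ n)) atTop (𝓝 (cutoffConst N s p α 1)) := by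
    have := tendsto_setLIntegral_iUnion (μ := volume) hImono (fun r =>
      ENNReal.ofReal (r ^ (p * s - 1) * |1 - r ^ α| ^ p) * angularKernel N s p r)
    rw [hIU] at this
    exact this
  have hE := tendsto_setLIntegral_iUnion
    (μ := (volume : Measure (EuclideanSpace ℝ (Fin N))).prod volume) hSmono
    (fun z => ENNReal.ofReal (‖u z.1 - u z.2‖ ^ p / ‖z.1 - z.2‖ ^ ((N : ℝ) + p * s)))
  have hR := tendsto_setLIntegral_iUnion
    (μ := (volume : Measure (EuclideanSpace ℝ (Fin N))).prod volume) hSmono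
    (remainderDensity N s p α u)
  rw [hSU] at hE hR
  -- All three terms are increasing in `ρ` and nonnegative, so the limit `ρ → 1` needs no
  -- integrability up to the diagonal.
  have hlim := tendsto_nhds_unique (hE.congr fun n =>
    energy_sector_eq hN hs0 hp hα hα0 (hρ n).1 (hρ n).2 hu hH)
    ((ENNReal.Tendsto.mul_const hC (Or.inr hH)).add hR)
  rw [energy, lintegral_eq_two_mul_sector hN (by fun_prop)
    (fun x y => by simp only [norm_sub_rev]), hlim,
    lintegral_eq_two_mul_sector hN (measurable_remainderDensity α hu) (fun x y => by
      unfold remainderDensity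
      rw [groundRemainder_comm, norm_sub_rev]), mul_add, ← mul_assoc]
  rfl

/-! ### Test functions: finite energy and finite Hardy integral. -/

theorem setLIntegral_ne_zero_of_pos {α : Type*} [MeasurableSpace α] {μ : Measure α} {S : Set α}
    (hS : MeasurableSet S) (hμ : μ S ≠ 0) {f : α → ℝ≥0∞} (hf : Measurable f)
    (hpos : ∀ x ∈ S, f x ≠ 0) : ∫⁻ x in S, f x ∂μ ≠ 0 := by
  intro h
  rw [lintegral_eq_zero_iff hf, EventuallyEq, ae_restrict_iff' hS] at h
  refine hμ (measure_mono_null (fun x hx => ?_) h)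
  simpa using ⟨hx, hpos x hx⟩

theorem lintegral_le_of_ae_tendsto {α : Type*} [MeasurableSpace α] {μ : Measure α}
    {F : ℕ → α → ℝ≥0∞} {f : α → ℝ≥0∞} (hF : ∀ n, Measurable (F n))
    (hlim : ∀ᵐ x ∂μ, Tendsto (fun n => F n x) atTop (𝓝 (f x))) {B : ℝ≥0∞}
    (hB : ∀ᶠ n in atTop, ∫⁻ x, F n x ∂μ ≤ B) : ∫⁻ x, f x ∂μ ≤ B :=
  calc ∫⁻ x, f x ∂μ = ∫⁻ x, liminf (fun n => F n x) atTop ∂μ :=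
        lintegral_congr_ae (hlim.mono fun _ hx => hx.liminf_eq.symm)
    _ ≤ liminf (fun n => ∫⁻ x, F n x ∂μ) atTop := lintegral_liminf_le hF
    _ ≤ B := liminf_le_of_frequently_le' hB.frequently

theorem norm_rpow_le_two_rpow_mul (hp : 1 ≤ p) (a b : ℂ) :
    ‖a‖ ^ p ≤ 2 ^ (p - 1) * (‖a - b‖ ^ p + ‖b‖ ^ p) := by
  have h := NNReal.rpow_add_le_mul_rpow_add_rpow ‖a - b‖₊ ‖b‖₊ hp
  have h2 : (‖a - b‖ + ‖b‖) ^ p ≤ 2 ^ (p - 1) * (‖a - b‖ ^ p + ‖b‖ ^ p) := by exact_mod_cast h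
  refine le_trans (Real.rpow_le_rpow (norm_nonneg _) ?_ (by linarith)) h2
  simpa using norm_add_le (a - b) b

theorem energy_le (hp : 1 ≤ p) {u w : EuclideanSpace ℝ (Fin N) → ℂ} (hu : Measurable u)
    (hw : Measurable w) :
    energy N s p u ≤ ENNReal.ofReal (2 ^ (p - 1)) * (energy N s p (u - w) + energy N s p w) := by
  unfold energy
  simp only [Pi.sub_apply]
  rw [← lintegral_add_left (by fun_prop), ← lintegral_const_mul' _ _ ENNReal.ofReal_ne_top]
  refine lintegral_mono fun z => ?_
  rw [← ENNReal.ofReal_add (by positivity) (by positivity), ← ENNReal.ofReal_mul (by positivity),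
    ← add_div, ← mul_div_assoc]
  refine ENNReal.ofReal_le_ofReal ?_
  gcongr
  have h := norm_rpow_le_two_rpow_mul hp (u z.1 - u z.2) (w z.1 - w z.2)
  rwa [show u z.1 - u z.2 - (w z.1 - w z.2) = u z.1 - w z.1 - (u z.2 - w z.2) by ring] at h

theorem hardyIntegral_le (hp : 1 ≤ p) {u w : EuclideanSpace ℝ (Fin N) → ℂ} (hu : Measurable u)
    (hw : Measurable w) :
    hardyIntegral N s p u
      ≤ ENNReal.ofReal (2 ^ (p - 1)) * (hardyIntegral N s p (u - w) + hardyIntegral N s p w) := by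
  unfold hardyIntegral
  simp only [Pi.sub_apply]
  rw [← lintegral_add_left (by fun_prop), ← lintegral_const_mul' _ _ ENNReal.ofReal_ne_top]
  refine lintegral_mono fun z => ?_
  rw [← ENNReal.ofReal_add (by positivity) (by positivity), ← ENNReal.ofReal_mul (by positivity),
    ← add_div, ← mul_div_assoc]
  refine ENNReal.ofReal_le_ofReal ?_
  gcongr
  exact norm_rpow_le_two_rpow_mul hp _ _

theorem IsTestFunction.sub {U : Set (EuclideanSpace ℝ (Fin N))}
    {φ ψ : EuclideanSpace ℝ (Fin N) → ℂ} (hφ : IsTestFunction N U φ) (hψ : IsTestFunction N U ψ) :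
    IsTestFunction N U (φ - ψ) := by
  have h : tsupport (φ - ψ) ⊆ tsupport φ ∪ tsupport ψ := tsupport_sub φ ψ
  refine ⟨hφ.1.sub hψ.1, ?_, h.trans (union_subset hφ.2.2 hψ.2.2)⟩
  exact (hφ.2.1.isCompact.union hψ.2.1.isCompact).of_isClosed_subset (isClosed_tsupport _) h

theorem IsTestFunction.measurable {U : Set (EuclideanSpace ℝ (Fin N))}
    {φ : EuclideanSpace ℝ (Fin N) → ℂ} (hφ : IsTestFunction N U φ) : Measurable φ :=
  hφ.1.continuous.measurable

/-- The radial majorants are `r^(p - ps - 1)` near `0`, integrable as `s < 1`, and `r^(-ps - 1)` at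
infinity, integrable as `s > 0`. With a Lipschitz constant and a bound for differences this controls
the energy of a test function. -/
theorem lintegral_min_rpow_lt_top (hN : 1 ≤ N) (hs0 : 0 < s) (hs1 : s < 1) (hp : 2 ≤ p)
    {L M : ℝ} (hL : 0 ≤ L) (hM : 0 ≤ M) :
    ∫⁻ z : EuclideanSpace ℝ (Fin N),
      ENNReal.ofReal ((min (L * ‖z‖) M) ^ p / ‖z‖ ^ ((N : ℝ) + p * s)) < ⊤ := by
  rw [lintegral_radial hN (f := fun r => ENNReal.ofReal ((min (L * r) M) ^ p /
    r ^ ((N : ℝ) + p * s))) (by fun_prop)]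
  refine ENNReal.mul_lt_top (measure_lt_top _ _) ?_
  rw [← Ioc_union_Ioi_eq_Ioi (zero_le_one (α := ℝ)), lintegral_union measurableSet_Ioi
    (Ioc_disjoint_Ioi le_rfl)]
  have hps : p * s < p := by nlinarith
  have hps0 : 0 < p * s := by positivity
  have hpow : ∀ r : ℝ, 0 < r → r ^ (N - 1) = r ^ ((N : ℝ) - 1) := by
    intro r hr
    rw [← Real.rpow_natCast, Nat.cast_sub hN]
    simp
  refine ENNReal.add_lt_top.2 ⟨?_, ?_⟩
  · have hint : IntegrableOn (fun r : ℝ => L ^ p * r ^ (p - p * s - 1)) (Ioc 0 1) :=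
      ((intervalIntegral.intervalIntegrable_rpow' (a := 0) (b := 1)
        (show -1 < p - p * s - 1 by linarith)).1).const_mul _
    refine lt_of_le_of_lt (setLIntegral_mono' measurableSet_Ioc fun r hr => ?_) hint.lintegral_lt_top
    have hr0 := hr.1
    rw [← ENNReal.ofReal_mul (by positivity), hpow r hr0]
    refine ENNReal.ofReal_le_ofReal ?_
    calc r ^ ((N : ℝ) - 1) * ((min (L * r) M) ^ p / r ^ ((N : ℝ) + p * s))
        ≤ r ^ ((N : ℝ) - 1) * ((L * r) ^ p / r ^ ((N : ℝ) + p * s)) := by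
          gcongr
          exact min_le_left _ _
      _ = L ^ p * r ^ (p - p * s - 1) := by
          have e : r ^ ((N : ℝ) - 1) * (r ^ p / r ^ ((N : ℝ) + p * s)) = r ^ (p - p * s - 1) := by
            rw [← Real.rpow_sub hr0, ← Real.rpow_add hr0]
            ring_nf
          rw [← e, Real.mul_rpow hL hr0.le]
          ring
  · have hint : IntegrableOn (fun r : ℝ => M ^ p * r ^ (-(p * s) - 1)) (Ioi 1) :=
      (integrableOn_Ioi_rpow_of_lt (by linarith) one_pos).const_mul _
    refine lt_of_le_of_lt (setLIntegral_mono' measurableSet_Ioi fun r hr => ?_) hint.lintegral_lt_top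
    have hr0 : 0 < r := one_pos.trans hr
    rw [← ENNReal.ofReal_mul (by positivity), hpow r hr0]
    refine ENNReal.ofReal_le_ofReal ?_
    calc r ^ ((N : ℝ) - 1) * ((min (L * r) M) ^ p / r ^ ((N : ℝ) + p * s))
        ≤ r ^ ((N : ℝ) - 1) * (M ^ p / r ^ ((N : ℝ) + p * s)) := by
          gcongr
          exact min_le_right _ _
      _ = M ^ p * r ^ (-(p * s) - 1) := by
          have e : r ^ ((N : ℝ) - 1) / r ^ ((N : ℝ) + p * s) = r ^ (-(p * s) - 1) := by
            rw [← Real.rpow_sub hr0]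
            ring_nf
          rw [← e]
          ring

theorem IsTestFunction.energy_lt_top (hN : 1 ≤ N) (hs0 : 0 < s) (hs1 : s < 1) (hp : 2 ≤ p)
    {U : Set (EuclideanSpace ℝ (Fin N))} {φ : EuclideanSpace ℝ (Fin N) → ℂ}
    (hφ : IsTestFunction N U φ) : energy N s p φ < ⊤ := by
  obtain ⟨hsmooth, hcomp, -⟩ := hφ
  obtain ⟨L, hL⟩ := hsmooth.lipschitzWith_of_hasCompactSupport hcomp (by simp)
  obtain ⟨M, hM⟩ := hcomp.exists_bound_of_continuous hsmooth.continuous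
  have hM0 : 0 ≤ M := (norm_nonneg _).trans (hM 0)
  set K := tsupport φ
  have hK : MeasurableSet K := (isClosed_tsupport φ).measurableSet
  let ψ : EuclideanSpace ℝ (Fin N) → ℝ≥0∞ := fun z =>
    ENNReal.ofReal ((min (L * ‖z‖) (2 * M)) ^ p / ‖z‖ ^ ((N : ℝ) + p * s))
  have hψ : Measurable ψ := by fun_prop
  have hψfin : ∫⁻ z, ψ z < ⊤ :=
    lintegral_min_rpow_lt_top hN hs0 hs1 hp L.coe_nonneg (by positivity)
  let χ : EuclideanSpace ℝ (Fin N) → ℝ≥0∞ := K.indicator 1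
  have hχ : Measurable χ := measurable_one.indicator hK
  have hχint : ∫⁻ x, χ x < ⊤ := by
    rw [lintegral_indicator_one hK]
    exact hcomp.isCompact.measure_lt_top
  -- The integrand vanishes unless one of the points lies in the support `K`. The double integral is
  -- thus at most twice the measure of `K` times the integral of `ψ`.
  have hbound : ∀ z : EuclideanSpace ℝ (Fin N) × EuclideanSpace ℝ (Fin N),
      ENNReal.ofReal (‖φ z.1 - φ z.2‖ ^ p / ‖z.1 - z.2‖ ^ ((N : ℝ) + p * s))
        ≤ χ z.1 * ψ (z.1 - z.2) + χ z.2 * ψ (z.1 - z.2) := by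
    intro z
    have h1 : ENNReal.ofReal (‖φ z.1 - φ z.2‖ ^ p / ‖z.1 - z.2‖ ^ ((N : ℝ) + p * s))
        ≤ ψ (z.1 - z.2) := by
      refine ENNReal.ofReal_le_ofReal ?_
      gcongr
      refine le_min ?_ ?_
      · simpa [dist_eq_norm] using hL.dist_le_mul z.1 z.2
      · have := norm_sub_le (φ z.1) (φ z.2)
        linarith [hM z.1, hM z.2]
    by_cases hz1 : z.1 ∈ K
    · simp only [χ, indicator_of_mem hz1, Pi.one_apply, one_mul]
      exact h1.trans le_self_add
    · by_cases hz2 : z.2 ∈ K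
      · simp only [χ, indicator_of_mem hz2, Pi.one_apply, one_mul]
        exact h1.trans le_add_self
      · rw [image_eq_zero_of_notMem_tsupport hz1, image_eq_zero_of_notMem_tsupport hz2]
        simp [Real.zero_rpow (show p ≠ 0 by linarith)]
  have hm1 : Measurable fun z : EuclideanSpace ℝ (Fin N) × EuclideanSpace ℝ (Fin N) =>
    χ z.1 * ψ (z.1 - z.2) := by fun_prop
  have hm2 : Measurable fun z : EuclideanSpace ℝ (Fin N) × EuclideanSpace ℝ (Fin N) =>
    χ z.2 * ψ (z.1 - z.2) := by fun_prop
  refine lt_of_le_of_lt (lintegral_mono hbound) ?_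
  rw [lintegral_add_left hm1, lintegral_prod _ hm1.aemeasurable,
    lintegral_prod_symm _ hm2.aemeasurable]
  refine ENNReal.add_lt_top.2 ⟨?_, ?_⟩
  · have : ∀ x, ∫⁻ y, χ x * ψ (x - y) = χ x * ∫⁻ z, ψ z := fun x => by
      rw [lintegral_const_mul _ (by fun_prop), lintegral_sub_left_eq_self]
    simp only [this]
    rw [lintegral_mul_const _ hχ]
    exact ENNReal.mul_lt_top hχint hψfin
  · have : ∀ y, ∫⁻ x, χ y * ψ (x - y) = χ y * ∫⁻ z, ψ z := fun y => by
      rw [lintegral_const_mul _ (by fun_prop), lintegral_sub_right_eq_self]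
    simp only [this]
    rw [lintegral_mul_const _ hχ]
    exact ENNReal.mul_lt_top hχint hψfin

theorem IsTestFunction.hardyIntegral_lt_top (hN : 1 ≤ N) (hp : 2 ≤ p)
    (hlt : p * s < N) {φ : EuclideanSpace ℝ (Fin N) → ℂ}
    (hφ : IsTestFunction N univ φ) : hardyIntegral N s p φ < ⊤ := by
  obtain ⟨hsmooth, hcomp, -⟩ := hφ
  obtain ⟨M, hM⟩ := hcomp.exists_bound_of_continuous hsmooth.continuous
  have hM0 : 0 ≤ M := (norm_nonneg _).trans (hM 0)
  obtain ⟨R, hR⟩ := hcomp.isCompact.isBounded.subset_closedBall 0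
  let f : ℝ → ℝ≥0∞ := (Iic R).indicator fun r => ENNReal.ofReal (M ^ p / r ^ (p * s))
  have hf : Measurable f := Measurable.indicator (by fun_prop) measurableSet_Iic
  have hbound : ∀ x, ENNReal.ofReal (‖φ x‖ ^ p / ‖x‖ ^ (p * s)) ≤ f ‖x‖ := by
    intro x
    by_cases hx : x ∈ tsupport φ
    · have hxR : ‖x‖ ≤ R := by simpa using hR hx
      simp only [f]
      rw [indicator_of_mem (show ‖x‖ ∈ Iic R from hxR)]
      refine ENNReal.ofReal_le_ofReal ?_
      gcongr
      exact hM x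
    · rw [image_eq_zero_of_notMem_tsupport hx]
      simp [Real.zero_rpow (show p ≠ 0 by linarith)]
  refine lt_of_le_of_lt (lintegral_mono hbound) ?_
  rw [lintegral_radial hN hf]
  refine ENNReal.mul_lt_top (measure_lt_top _ _) ?_
  have hint : IntegrableOn (fun r : ℝ => M ^ p * r ^ ((N : ℝ) - 1 - p * s)) (Ioc 0 R) := by
    rcases le_total 0 R with h0 | h0
    · rw [← intervalIntegrable_iff_integrableOn_Ioc_of_le h0]
      exact (intervalIntegral.intervalIntegrable_rpow' (by linarith)).const_mul _
    · rw [Ioc_eq_empty (not_lt.2 h0)]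
      exact integrableOn_empty
  refine lt_of_le_of_lt ?_ hint.lintegral_lt_top
  rw [← lintegral_indicator measurableSet_Ioi, ← lintegral_indicator measurableSet_Ioc]
  refine lintegral_mono fun r => ?_
  by_cases h0 : 0 < r
  · by_cases h2 : r ≤ R
    · rw [indicator_of_mem (show r ∈ Ioi 0 from h0), indicator_of_mem (show r ∈ Ioc 0 R from ⟨h0, h2⟩)]
      simp only [f]
      rw [indicator_of_mem (show r ∈ Iic R from h2), ← ENNReal.ofReal_mul (by positivity)]
      refine ENNReal.ofReal_le_ofReal (le_of_eq ?_)
      rw [Real.rpow_sub h0, ← Real.rpow_natCast, Nat.cast_sub hN, Nat.cast_one]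
      ring
    · simp [f, h0, h2]
  · simp [h0]

theorem IsTestFunction.hardyIntegral_lt_top_of_compl (hs0 : 0 < s) (hp : 2 ≤ p)
    {φ : EuclideanSpace ℝ (Fin N) → ℂ}
    (hφ : IsTestFunction N {0}ᶜ φ) : hardyIntegral N s p φ < ⊤ := by
  obtain ⟨hsmooth, hcomp, hsupp⟩ := hφ
  obtain ⟨M, hM⟩ := hcomp.exists_bound_of_continuous hsmooth.continuous
  have h0 : (0 : EuclideanSpace ℝ (Fin N)) ∈ (tsupport φ)ᶜ := fun h => hsupp h rfl
  obtain ⟨δ, hδ, hball⟩ := Metric.isOpen_iff.1 (isClosed_tsupport φ).isOpen_compl 0 h0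
  have hbound : ∀ x, ENNReal.ofReal (‖φ x‖ ^ p / ‖x‖ ^ (p * s))
      ≤ (tsupport φ).indicator (fun _ => ENNReal.ofReal (M ^ p / δ ^ (p * s))) x := by
    intro x
    by_cases hx : x ∈ tsupport φ
    · have hxδ : δ ≤ ‖x‖ := by
        by_contra! h
        exact hball (by simpa using h) hx
      have hM0 : 0 ≤ M := (norm_nonneg _).trans (hM 0)
      rw [indicator_of_mem hx]
      refine ENNReal.ofReal_le_ofReal ?_
      gcongr
      exact hM x
    · rw [image_eq_zero_of_notMem_tsupport hx]
      simp [Real.zero_rpow (show p ≠ 0 by linarith)]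
  refine lt_of_le_of_lt (lintegral_mono hbound) ?_
  rw [lintegral_indicator_const (isClosed_tsupport φ).measurableSet]
  exact ENNReal.mul_lt_top ENNReal.ofReal_lt_top hcomp.isCompact.measure_lt_top

/-! ### Positivity and finiteness of the Hardy constant. -/

theorem exists_isTestFunction (hN : 1 ≤ N) (s p : ℝ) :
    ∃ φ : EuclideanSpace ℝ (Fin N) → ℂ, IsTestFunction N {0}ᶜ φ ∧ hardyIntegral N s p φ ≠ 0 := by
  obtain ⟨d, rfl⟩ : ∃ d, N = d + 1 := ⟨N - 1, by omega⟩
  set e : EuclideanSpace ℝ (Fin (d + 1)) := EuclideanSpace.single 0 1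
  have he : ‖e‖ = 1 := by simp [e]
  let b : ContDiffBump e := ⟨1 / 4, 1 / 2, by norm_num, by norm_num⟩
  let φ : EuclideanSpace ℝ (Fin (d + 1)) → ℂ := fun x => (b x : ℂ)
  have hsupp : Function.support φ = Metric.ball e (1 / 2) := by
    have : Function.support φ = Function.support b := by
      ext x
      simp [φ]
    rw [this, b.support_eq]
  have htsupp : tsupport φ = Metric.closedBall e (1 / 2) := by
    rw [tsupport, hsupp, closure_ball e (by norm_num)]
  have hsmooth : ContDiff ℝ ∞ φ := Complex.ofRealCLM.contDiff.comp b.contDiff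
  have hball : ∀ x ∈ Metric.closedBall e (1 / 2), x ≠ 0 := by
    rintro x hx rfl
    rw [Metric.mem_closedBall, dist_zero_left, he] at hx
    norm_num at hx
  refine ⟨φ, ⟨hsmooth, ?_, ?_⟩, ?_⟩
  · rw [HasCompactSupport, htsupp]
    exact isCompact_closedBall _ _
  · rw [htsupp]
    exact fun x hx => hball x hx
  · have hm : Measurable φ := hsmooth.continuous.measurable
    have h := setLIntegral_ne_zero_of_pos (μ := volume) (S := Metric.ball e (1 / 2))
      measurableSet_ball (Metric.measure_ball_pos _ _ (by norm_num)).ne'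
      (f := fun x => ENNReal.ofReal (‖φ x‖ ^ p / ‖x‖ ^ (p * s))) (by fun_prop) (fun x hx => by
        have h1 : 0 < ‖φ x‖ := norm_pos_iff.2 (by rw [← hsupp] at hx; exact hx)
        have h2 : 0 < ‖x‖ := norm_pos_iff.2 (hball x (Metric.ball_subset_closedBall hx))
        have : 0 < ‖φ x‖ ^ p / ‖x‖ ^ (p * s) := by positivity
        simpa using this)
    intro h0
    exact h (le_antisymm ((setLIntegral_le_lintegral _ _).trans h0.le) bot_le)

theorem sphereArea_ne_zero {d : ℕ} (hd : 1 ≤ d) : sphereArea d ≠ 0 := by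
  have : Nonempty (Fin d) := ⟨⟨0, hd⟩⟩
  unfold sphereArea
  rw [Ne, Measure.measure_univ_eq_zero]
  exact Measure.toSphere_ne_zero _

theorem angularKernel_ne_zero (hN : 1 ≤ N) (s p : ℝ) {r : ℝ} (h0 : 0 < r) (h1 : r < 1) :
    angularKernel N s p r ≠ 0 := by
  unfold angularKernel
  split_ifs with h
  · have h2 : 0 < 1 - r := by linarith
    have : 0 < 1 / (1 - r) ^ (1 + p * s) + 1 / (1 + r) ^ (1 + p * s) := by positivity
    simpa using this
  · refine mul_ne_zero (sphereArea_ne_zero (by omega)) (setLIntegral_ne_zero_of_pos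
      measurableSet_Ioo (by simp) (by fun_prop) fun t ht => ?_)
    have h2 : 0 < 1 - t ^ 2 := by nlinarith [ht.1, ht.2]
    have h3 : 0 < 1 - 2 * r * t + r ^ 2 := by nlinarith [ht.1, ht.2, sq_nonneg (1 - r)]
    have : 0 < (1 - t ^ 2) ^ (((N : ℝ) - 3) / 2)
        / (1 - 2 * r * t + r ^ 2) ^ (((N : ℝ) + p * s) / 2) := by positivity
    simpa using this

/-- For `α ≠ 0` the factor `|1 - r^α|` is positive on `(0, 1)`. This lets the energy bound the Hardy
integral along Cauchy sequences. -/
theorem hardyConst_ne_zero (hN : 1 ≤ N) (hα0 : ((N : ℝ) - p * s) / p ≠ 0) :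
    hardyConst N s p ≠ 0 := by
  have hm := measurable_angularKernel N s p
  refine mul_ne_zero two_ne_zero (setLIntegral_ne_zero_of_pos measurableSet_Ioo (by simp)
    (by fun_prop) fun r hr => mul_ne_zero ?_ (angularKernel_ne_zero hN s p hr.1 hr.2))
  have h0 := hr.1
  have h1 : 0 < |1 - r ^ (((N : ℝ) - p * s) / p)| := by
    rw [abs_pos, sub_ne_zero]
    intro h
    have h2 := congrArg Real.log h
    rw [Real.log_rpow h0, Real.log_one] at h2
    exact mul_ne_zero hα0 (Real.log_neg h0 hr.2).ne h2.symm
  have : 0 < r ^ (p * s - 1) * |1 - r ^ (((N : ℝ) - p * s) / p)| ^ p := by positivity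
  simpa using this

theorem hardyConst_mul_le_energy (hN : 1 ≤ N) (hs0 : 0 < s) (hp : 2 ≤ p)
    (hα0 : ((N : ℝ) - p * s) / p ≠ 0)
    {u : EuclideanSpace ℝ (Fin N) → ℂ} (hu : Measurable u) (hH : hardyIntegral N s p u ≠ ⊤) :
    hardyConst N s p * hardyIntegral N s p u ≤ energy N s p u := by
  rw [energy_eq_add_remainder hN hs0 hp hα0 hu hH]
  exact le_self_add

/-- No estimate of the kernel near `r = 1` is made: for a bump function away from the origin, the
constant times a nonzero Hardy integral is at most a finite energy. -/
theorem hardyConst_lt_top (hN : 1 ≤ N) (hs0 : 0 < s) (hs1 : s < 1) (hp : 2 ≤ p)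
    (hα0 : ((N : ℝ) - p * s) / p ≠ 0) : hardyConst N s p < ⊤ := by
  obtain ⟨φ, hφ, hφ0⟩ := exists_isTestFunction hN s p
  have h := (hardyConst_mul_le_energy hN hs0 hp hα0 hφ.measurable
    (hφ.hardyIntegral_lt_top_of_compl hs0 hp).ne).trans_lt (hφ.energy_lt_top hN hs0 hs1 hp)
  exact ENNReal.lt_top_of_mul_ne_top_left h.ne hφ0

/-! ### Passage to the completion. -/

theorem ae_prod_eq {u w : EuclideanSpace ℝ (Fin N) → ℂ} (h : u =ᵐ[volume] w) :
    ∀ᵐ z ∂((volume : Measure (EuclideanSpace ℝ (Fin N))).prod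
      (volume : Measure (EuclideanSpace ℝ (Fin N)))), u z.1 = w z.1 ∧ u z.2 = w z.2 :=
  (Measure.quasiMeasurePreserving_fst.ae h).and (Measure.quasiMeasurePreserving_snd.ae h)

theorem energy_congr_ae {u w : EuclideanSpace ℝ (Fin N) → ℂ} (h : u =ᵐ[volume] w) :
    energy N s p u = energy N s p w :=
  lintegral_congr_ae ((ae_prod_eq h).mono fun z hz => by simp only [hz.1, hz.2])

theorem weightedEnergy_congr_ae {u w : EuclideanSpace ℝ (Fin N) → ℂ} (h : u =ᵐ[volume] w) :
    weightedEnergy N s p u = weightedEnergy N s p w :=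
  lintegral_congr_ae ((ae_prod_eq h).mono fun z hz => by simp only [hz.1, hz.2])

theorem hardyIntegral_congr_ae {u w : EuclideanSpace ℝ (Fin N) → ℂ} (h : u =ᵐ[volume] w) :
    hardyIntegral N s p u = hardyIntegral N s p w :=
  lintegral_congr_ae (h.mono fun z hz => by simp only [hz])

theorem energy_le_of_ae_tendsto {φ : ℕ → EuclideanSpace ℝ (Fin N) → ℂ}
    {u : EuclideanSpace ℝ (Fin N) → ℂ} (hp : 0 ≤ p) (hφ : ∀ n, Measurable (φ n))
    (hlim : ∀ᵐ x, Tendsto (fun n => φ n x) atTop (𝓝 (u x))) {B : ℝ≥0∞}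
    (hB : ∀ᶠ n in atTop, energy N s p (φ n) ≤ B) : energy N s p u ≤ B := by
  refine lintegral_le_of_ae_tendsto (fun n => by have := hφ n; fun_prop) ?_ hB
  filter_upwards [Measure.quasiMeasurePreserving_fst.ae hlim,
    Measure.quasiMeasurePreserving_snd.ae hlim] with z h1 h2
  exact ENNReal.tendsto_ofReal
    (((h1.sub h2).norm.rpow_const (Or.inr hp)).div_const _)

theorem hardyIntegral_le_of_ae_tendsto {φ : ℕ → EuclideanSpace ℝ (Fin N) → ℂ}
    {u : EuclideanSpace ℝ (Fin N) → ℂ} (hp : 0 ≤ p) (hφ : ∀ n, Measurable (φ n))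
    (hlim : ∀ᵐ x, Tendsto (fun n => φ n x) atTop (𝓝 (u x))) {B : ℝ≥0∞}
    (hB : ∀ᶠ n in atTop, hardyIntegral N s p (φ n) ≤ B) : hardyIntegral N s p u ≤ B := by
  refine lintegral_le_of_ae_tendsto (fun n => by have := hφ n; fun_prop) ?_ hB
  filter_upwards [hlim] with x h
  exact ENNReal.tendsto_ofReal ((h.norm.rpow_const (Or.inr hp)).div_const _)

/-- Elements of the homogeneous Sobolev space have finite energy and Hardy integral, provided
test functions have finite Hardy integral. -/
theorem lt_top_of_mem_homogeneousSobolev (hN : 1 ≤ N) (hs0 : 0 < s) (hs1 : s < 1) (hp : 2 ≤ p)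
    (hα0 : ((N : ℝ) - p * s) / p ≠ 0) {U : Set (EuclideanSpace ℝ (Fin N))}
    (hU : ∀ φ, IsTestFunction N U φ → hardyIntegral N s p φ < ⊤)
    {u : EuclideanSpace ℝ (Fin N) → ℂ} (hu : Measurable u)
    {φ : ℕ → EuclideanSpace ℝ (Fin N) → ℂ} (hφ : ∀ n, IsTestFunction N U (φ n))
    (hcauchy : Tendsto (fun q : ℕ × ℕ => energy N s p (φ q.1 - φ q.2)) atTop (𝓝 0))
    (hlim : ∀ᵐ x, Tendsto (fun n => φ n x) atTop (𝓝 (u x))) :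
    energy N s p u < ⊤ ∧ hardyIntegral N s p u < ⊤ := by
  have hm := fun n => (hφ n).measurable
  have hC0 := hardyConst_ne_zero (s := s) (p := p) hN hα0
  have hp0 : 0 ≤ p := by linarith
  -- Freeze `m` so that `φ k - φ m` has energy at most `1` for large `k`. The Hardy inequality for
  -- these test functions bounds their Hardy integrals, Fatou's lemma yields both bounds for `u - φ
  -- m`, and adding `φ m` back preserves finiteness.
  obtain ⟨⟨n, m⟩, hnm⟩ := eventually_atTop.1 (hcauchy.eventually_le_const one_pos)
  have hE : ∀ᶠ k in atTop, energy N s p (φ k - φ m) ≤ 1 := by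
    filter_upwards [eventually_ge_atTop n] with k hk
    exact hnm (k, m) ⟨hk, le_rfl⟩
  have hH : ∀ᶠ k in atTop, hardyIntegral N s p (φ k - φ m) ≤ (hardyConst N s p)⁻¹ := by
    filter_upwards [hE] with k hk
    have hd := (hφ k).sub (hφ m)
    have h := (hardyConst_mul_le_energy hN hs0 hp hα0 hd.measurable (hU _ hd).ne).trans hk
    rw [ENNReal.le_inv_iff_mul_le, mul_comm]
    exact h
  have hlim' : ∀ᵐ x, Tendsto (fun k => (φ k - φ m) x) atTop (𝓝 ((u - φ m) x)) := by
    filter_upwards [hlim] with x hx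
    exact hx.sub_const _
  have hmd : ∀ k, Measurable (φ k - φ m) := fun k => (hm k).sub (hm m)
  have h1 := energy_le_of_ae_tendsto hp0 hmd hlim' hE
  have h2 := hardyIntegral_le_of_ae_tendsto hp0 hmd hlim' hH
  constructor
  · refine (energy_le (by linarith) hu (hm m)).trans_lt (ENNReal.mul_lt_top ENNReal.ofReal_lt_top
      (ENNReal.add_lt_top.2 ⟨h1.trans_lt ENNReal.one_lt_top,
        (hφ m).energy_lt_top hN hs0 hs1 hp⟩))
  · refine (hardyIntegral_le (by linarith) hu (hm m)).trans_lt
      (ENNReal.mul_lt_top ENNReal.ofReal_lt_top (ENNReal.add_lt_top.2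
        ⟨h2.trans_lt (ENNReal.inv_lt_top.2 (pos_iff_ne_zero.2 hC0)), hU _ (hφ m)⟩))

/-! ### From the remainder to the weighted energy, and the theorem. -/

theorem groundWeight_eq {a b : ℝ} (ha : 0 < a) (hb : 0 < b) (hp : p ≠ 0) :
    (a ^ (-(((N : ℝ) - p * s) / p)) * b ^ (-(((N : ℝ) - p * s) / p))) ^ (p / 2)
      = 1 / a ^ (((N : ℝ) - p * s) / 2) * (1 / b ^ (((N : ℝ) - p * s) / 2)) := by
  have e : -(((N : ℝ) - p * s) / p) * (p / 2) = -(((N : ℝ) - p * s) / 2) := by field_simp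
  rw [Real.mul_rpow (by positivity) (by positivity), ← Real.rpow_mul ha.le, ← Real.rpow_mul hb.le,
    e, Real.rpow_neg ha.le, Real.rpow_neg hb.le, one_div, one_div]

theorem remainderConst_mul_weightedEnergy_le (hN : 1 ≤ N) (hp : 2 ≤ p)
    {u v : EuclideanSpace ℝ (Fin N) → ℂ}
    (hv : ∀ x, v x = ((‖x‖ ^ (((N : ℝ) - p * s) / p) : ℝ) : ℂ) * u x) :
    ENNReal.ofReal (remainderConst p) * weightedEnergy N s p v
      ≤ ∫⁻ z, remainderDensity N s p (((N : ℝ) - p * s) / p) u z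
        ∂((volume : Measure (EuclideanSpace ℝ (Fin N))).prod volume) := by
  unfold weightedEnergy
  rw [← lintegral_const_mul' _ _ ENNReal.ofReal_ne_top]
  refine lintegral_mono_ae ?_
  filter_upwards [ae_prod_ne_zero hN] with z hz
  have h := le_groundRemainder hp hz.1 hz.2 (hv z.1) (hv z.2)
  rw [groundWeight_eq (norm_pos_iff.2 hz.1) (norm_pos_iff.2 hz.2) (by linarith)] at h
  rw [← ENNReal.ofReal_mul (remainderConst_pos hp).le, remainderDensity]
  refine ENNReal.ofReal_le_ofReal (le_trans (le_of_eq ?_)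
    (div_le_div_of_nonneg_right h (Real.rpow_nonneg (norm_nonneg (z.1 - z.2)) _)))
  ring

theorem weightedEnergy_two_eq (hN : 1 ≤ N) {u v : EuclideanSpace ℝ (Fin N) → ℂ}
    (hv : ∀ x, v x = ((‖x‖ ^ (((N : ℝ) - 2 * s) / 2) : ℝ) : ℂ) * u x) :
    weightedEnergy N s 2 v
      = ∫⁻ z, remainderDensity N s 2 (((N : ℝ) - 2 * s) / 2) u z
        ∂((volume : Measure (EuclideanSpace ℝ (Fin N))).prod volume) := by
  refine lintegral_congr_ae ?_
  filter_upwards [ae_prod_ne_zero hN] with z hz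
  have h := groundRemainder_two hz.1 hz.2 (hv z.1) (hv z.2)
  rw [groundWeight_eq (norm_pos_iff.2 hz.1) (norm_pos_iff.2 hz.2) two_ne_zero] at h
  rw [remainderDensity, h]
  congr 1
  ring

/-- The sharp Hardy inequality with remainder for functions with finite energy. -/
theorem hardy_with_remainder (hN : 1 ≤ N) (hs0 : 0 < s) (hs1 : s < 1) (hp : 2 ≤ p)
    (hα0 : ((N : ℝ) - p * s) / p ≠ 0) {u v : EuclideanSpace ℝ (Fin N) → ℂ} (hu : Measurable u)
    (hE : energy N s p u < ⊤) (hH : hardyIntegral N s p u < ⊤)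
    (hv : ∀ x, v x = ((‖x‖ ^ (((N : ℝ) - p * s) / p) : ℝ) : ℂ) * u x) :
    weightedEnergy N s p v < ⊤ ∧
      (energy N s p u).toReal - (hardyConst N s p).toReal * (hardyIntegral N s p u).toReal
        ≥ remainderConst p * (weightedEnergy N s p v).toReal ∧
      (p = 2 →
        (energy N s p u).toReal - (hardyConst N s p).toReal * (hardyIntegral N s p u).toReal
          = (weightedEnergy N s p v).toReal) := by
  have hid := energy_eq_add_remainder hN hs0 hp hα0 hu hH.ne
  have hle := remainderConst_mul_weightedEnergy_le hN hp hv
  have hCfin := hardyConst_lt_top hN hs0 hs1 hp hα0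
  set R := ∫⁻ z, remainderDensity N s p (((N : ℝ) - p * s) / p) u z
    ∂((volume : Measure (EuclideanSpace ℝ (Fin N))).prod volume) with hR
  have hRfin : R < ⊤ := lt_of_le_of_lt (hid ▸ le_add_self) hE
  have hc := remainderConst_pos hp
  have hreal : (energy N s p u).toReal
      - (hardyConst N s p).toReal * (hardyIntegral N s p u).toReal = R.toReal := by
    rw [hid, ENNReal.toReal_add (ENNReal.mul_lt_top hCfin hH).ne hRfin.ne, ENNReal.toReal_mul]
    ring
  refine ⟨?_, ?_, ?_⟩
  · exact ENNReal.lt_top_of_mul_ne_top_right (hle.trans_lt hRfin).ne (by simpa using hc)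
  · rw [hreal, ge_iff_le, ← ENNReal.toReal_ofReal hc.le, ← ENNReal.toReal_mul]
    exact ENNReal.toReal_mono hRfin.ne hle
  · rintro rfl
    rw [hreal, hR, weightedEnergy_two_eq hN hv]

end FractionalHardy

theorem theorem1p2 (N : ℕ) (hN : 1 ≤ N) (s : ℝ) (hs0 : 0 < s) (hs1 : s < 1)
    (p : ℝ) (hp : 2 ≤ p) :
    -- the constants are well defined: `C_{N,s,p}` is finite and `c_p` is an attained minimum
    (p ≠ N / s → FractionalHardy.hardyConst N s p < ⊤) ∧
    IsLeast (FractionalHardy.remainderFun p '' Set.Ioo (0 : ℝ) (1 / 2))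
      (FractionalHardy.remainderConst p) ∧
    0 < FractionalHardy.remainderConst p ∧ FractionalHardy.remainderConst p ≤ 1 ∧
    (p = 2 → FractionalHardy.remainderConst p = 1) ∧
    -- the inequality, in which all integrals are finite
    ∀ u v : EuclideanSpace ℝ (Fin N) → ℂ,
      ((p < N / s ∧ u ∈ FractionalHardy.homogeneousSobolev N s p Set.univ) ∨
        (N / s < p ∧ u ∈ FractionalHardy.homogeneousSobolev N s p {0}ᶜ)) →
      (∀ x, v x = ((‖x‖ ^ (((N : ℝ) - p * s) / p) : ℝ) : ℂ) * u x) →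
      FractionalHardy.energy N s p u < ⊤ ∧
      FractionalHardy.hardyIntegral N s p u < ⊤ ∧
      FractionalHardy.weightedEnergy N s p v < ⊤ ∧
      (FractionalHardy.energy N s p u).toReal
          - (FractionalHardy.hardyConst N s p).toReal
            * (FractionalHardy.hardyIntegral N s p u).toReal
        ≥ FractionalHardy.remainderConst p * (FractionalHardy.weightedEnergy N s p v).toReal ∧
      (p = 2 →
        (FractionalHardy.energy N s p u).toReal
            - (FractionalHardy.hardyConst N s p).toReal
              * (FractionalHardy.hardyIntegral N s p u).toReal
          = (FractionalHardy.weightedEnergy N s p v).toReal) := by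
  have hα : p ≠ N / s → ((N : ℝ) - p * s) / p ≠ 0 := by
    intro h h0
    rw [div_eq_zero_iff] at h0
    rcases h0 with h0 | h0
    · exact h (by rw [eq_div_iff hs0.ne']; linarith)
    · linarith
  refine ⟨fun h => FractionalHardy.hardyConst_lt_top hN hs0 hs1 hp (hα h),
    FractionalHardy.isLeast_remainderConst hp, FractionalHardy.remainderConst_pos hp,
    FractionalHardy.remainderConst_le_one hp, ?_, fun u v hu hv => ?_⟩
  · rintro rfl
    exact FractionalHardy.remainderConst_two
  have hpN : p ≠ N / s := by
    rcases hu with ⟨h, -⟩ | ⟨h, -⟩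
    · exact h.ne
    · exact h.ne'
  obtain ⟨U, hU, φ, hφ, hcauchy, hlim⟩ : ∃ U : Set (EuclideanSpace ℝ (Fin N)),
      (∀ φ, FractionalHardy.IsTestFunction N U φ → FractionalHardy.hardyIntegral N s p φ < ⊤) ∧
      u ∈ FractionalHardy.homogeneousSobolev N s p U := by
    rcases hu with ⟨h, hu⟩ | ⟨h, hu⟩
    · exact ⟨_, fun φ hφ => hφ.hardyIntegral_lt_top hN hp ((lt_div_iff₀ hs0).1 h), hu⟩
    · exact ⟨_, fun φ hφ => hφ.hardyIntegral_lt_top_of_compl hs0 hp, hu⟩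
  -- An almost everywhere limit need not be Borel measurable, so `u` is replaced by a measurable
  -- representative. None of the integrals changes.
  have hae : AEMeasurable u := aemeasurable_of_tendsto_metrizable_ae atTop
    (fun n => (hφ n).measurable.aemeasurable) hlim
  have huw : u =ᵐ[MeasureTheory.volume] hae.mk u := hae.ae_eq_mk
  have hvw : v =ᵐ[MeasureTheory.volume]
      fun x => ((‖x‖ ^ (((N : ℝ) - p * s) / p) : ℝ) : ℂ) * hae.mk u x := by
    filter_upwards [huw] with x hx
    rw [hv, hx]
  have hlim' : ∀ᵐ x, Tendsto (fun n => φ n x) atTop (𝓝 (hae.mk u x)) := by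
    filter_upwards [hlim, huw] with x h1 h2
    rwa [← h2]
  obtain ⟨hE, hH⟩ := FractionalHardy.lt_top_of_mem_homogeneousSobolev hN hs0 hs1 hp (hα hpN) hU
    hae.measurable_mk hφ hcauchy hlim'
  rw [FractionalHardy.energy_congr_ae huw, FractionalHardy.hardyIntegral_congr_ae huw,
    FractionalHardy.weightedEnergy_congr_ae hvw]
  exact ⟨hE, hH, FractionalHardy.hardy_with_remainder hN hs0 hs1 hp (hα hpN)
    hae.measurable_mk hE hH fun x => rfl⟩
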